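/- **Setting.** Let $U$ be a unitary on a finite-dimensional complex Hilbert space with orthonormal eigenbasis $U|\phi_j\rangle=e^{i\phi_j}|\phi_j\rangle$, $\phi_j\in[0,2\pi)$, let $|\psi\rangle$ be a unit vector and put $a_j=|\langle\phi_j|\psi\rangle|^2$. For $\sigma>0$ let $f_\sigma$ be the $2\pi$-periodic Gaussian kernel that equals $e^{-x^2/2\sigma^2}\big/\int_{-\pi}^{\pi}e^{-y^2/2\sigma^2}\,dy$ on $(-\pi,\pi]$. One run of the (noiseless) phase estimation circuit makes $t$ calls to controlled-$U$ and returns a sample from the density $p(x)=\sum_j a_j f_\sigma(x-\phi_j)$ on $[0,2\pi)$, where $\sigma=\Theta(t^{-1})$, i.e. $\kappa_1\le t\sigma\le\kappa_2$ for fixed constants $0<\kappa_1\le\kappa_2$ (the cost of approximating the exact Gaussian kernel is neglected). Given $\phi_{\rm guess}$ and $\Delta$, put $\mathcal D=[\phi_{\rm guess}-\Delta/2,\ \phi_{\rm guess}+\Delta/2]$. The filtered moment projection phase estimator (fMPE) with $M$ filtered samples runs the circuit independently, discarding outcomes outside $\mathcal D$, until $M$ outcomes $x_1,\dots,x_M\in\mathcal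 D$ have been accepted, and returns $$\tilde\phi=\operatorname*{arg\,max}_{\phi\in\mathcal D}\ \frac1M\sum_{i=1}^M\log Q(x_i|\phi),\qquad Q(x|\phi)=\frac{f_\sigma(x-\phi)}{\int_{\mathcal D}f_\sigma(y-\phi)\,dy}.$$ **Theorem (cost of noiseless fMPE).** For all $0<\kappa_1\le\kappa_2$ there is a constant $c_0>0$ such that for every $B>0$ there is a constant $C>0$ with the following property. Let $0<\Delta\le\pi$, $\eta>0$, $0<\varepsilon\le\Delta$, $\sigma>0$ and $t\in\mathbb N$ satisfy $\kappa_1\le t\sigma\le\kappa_2$, $$t\ \ge\ c_0\,\Delta^{-1}\log^{1/2}\!\big(\Delta\varepsilon^{-1}\eta^{-1}\big)\qquad\text{and}\qquad t\varepsilon\le B .$$ Then there is a number $M\ge1$ of filtered samples, not depending on $U$, $\psi$ or $\phi_{\rm guess}$, such that for all $U$, $|\psi\rangle$, target eigenphase $\phi_0$ and $\phi_{\rm guess}$ with * $|\phi_j-\phi_0|>\Delta$ for all $j\ne0$ (spectral gap), * $|\langle\phi_0|\psi\rangle|^2>\eta$ (overlap), * $|\phi_0-\phi_{\rm guess}|<\Delta/3$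 (initial guess), * $\mathcal D\subseteq[\Delta/6,\,2\pi-\Delta/6)$ (the interval does not wrap around the circle), the fMPE is well defined (the maximizer exists and is unique for all samples in $\mathcal D$), its root-mean-square error satisfies $\sqrt{\mathbb E[(\tilde\phi-\phi_0)^2]}\le\varepsilon$, the expected total number of circuit samples (accepted or not) is at most $C\,\eta^{-1}t^{-2}\varepsilon^{-2}$, and the expected total number of calls to $U$ is at most $C\,\eta^{-1}t^{-1}\varepsilon^{-2}$. -/

import Mathlib

open MeasureTheory ProbabilityTheory
open scoped ENNReal

namespace PhaseEstimation

noncomputable section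

/-- An orthonormal eigenbasis of a unitary `U`, with eigenvalues `exp (i φ_j)` and eigenphases
`φ_j ∈ [0, 2π)`. -/
structure EigenDecomposition {H : Type*} [NormedAddCommGroup H] [InnerProductSpace ℂ H]
    (U : H ≃ₗᵢ[ℂ] H) (ι : Type*) [Fintype ι] where
  basis : OrthonormalBasis ι ℂ H
  phase : ι → ℝ
  phase_mem : ∀ j, phase j ∈ Set.Ico 0 (2 * Real.pi)
  eigen : ∀ j, U (basis j) = Complex.exp (phase j * Complex.I) • basis j

/-- The weight `a_j = |⟨φ_j|ψ⟩|²` of the state `ψ` on the `j`-th eigenvector. -/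
def EigenDecomposition.weight {H : Type*} [NormedAddCommGroup H] [InnerProductSpace ℂ H]
    {U : H ≃ₗᵢ[ℂ] H} {ι : Type*} [Fintype ι] (E : EigenDecomposition U ι) (ψ : H) (j : ι) : ℝ :=
  ‖inner ℂ (E.basis j) ψ‖ ^ 2

/-- The Gaussian kernel of width `σ` on the circle: the `2π`-periodic function that equals
`exp (-x² / 2σ²) / ∫_{-π}^{π} exp (-y² / 2σ²) dy` for `x ∈ (-π, π]`. -/
def gaussianKernel (σ x : ℝ) : ℝ :=
  Real.exp (-(toIocMod Real.two_pi_pos (-Real.pi) x) ^ 2 / (2 * σ ^ 2)) /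
    ∫ y in (-Real.pi)..Real.pi, Real.exp (-y ^ 2 / (2 * σ ^ 2))

/-- The smoothed spectral distribution: the measure on `[0, 2π)` with density
`x ↦ ∑_j a_j f (x - φ_j)`.  It is the law of the outcome of one run of the (noiseless) phase
estimation circuit with kernel `f`. -/
def EigenDecomposition.outcomeLaw {H : Type*} [NormedAddCommGroup H] [InnerProductSpace ℂ H]
    {U : H ≃ₗᵢ[ℂ] H} {ι : Type*} [Fintype ι] (E : EigenDecomposition U ι) (ψ : H)
    (f : ℝ → ℝ) : Measure ℝ :=
  (volume.restrict (Set.Ico 0 (2 * Real.pi))).withDensity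
    fun x => ENNReal.ofReal (∑ j, E.weight ψ j * f (x - E.phase j))

/-- The single-phase model `Q(x|φ) = f (x - φ) / ∫_D f (y - φ) dy` on the interval `D`. -/
def singlePhaseModel (f : ℝ → ℝ) (D : Set ℝ) (x φ : ℝ) : ℝ :=
  f (x - φ) / ∫ y in D, f (y - φ)

/-- The log-likelihood `(1/M) ∑_j log Q(x_j|φ)` of the samples `x_1, …, x_M`. -/
def logLikelihood (Q : ℝ → ℝ → ℝ) {M : ℕ} (x : Fin M → ℝ) (φ : ℝ) : ℝ :=
  (1 / (M : ℝ)) * ∑ j, Real.log (Q (x j) φ)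

/-- `φ` is a moment projection estimate from the samples `x`: it maximizes the log-likelihood of
the model `Q` over the parameter set `Dφ`. -/
def IsMomentProjection (Q : ℝ → ℝ → ℝ) (Dφ : Set ℝ) {M : ℕ} (x : Fin M → ℝ) (φ : ℝ) : Prop :=
  φ ∈ Dφ ∧ IsMaxOn (logLikelihood Q x) Dφ φ

/-- The filtered moment projection phase estimate with kernel `f` and filter interval `D`. -/
def IsFMPE (f : ℝ → ℝ) (D : Set ℝ) {M : ℕ} (x : Fin M → ℝ) (φ : ℝ) : Prop :=
  IsMomentProjection (singlePhaseModel f D) D x φ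

/-- The number of circuit runs made until the first outcome in `D` (infinite if there is none),
for the sequence `x 0, x 1, …` of outcomes of successive runs. -/
def runsUntilAccept (D : Set ℝ) (x : ℕ → ℝ) : ℝ≥0∞ :=
  ⨅ (k : ℕ) (_ : x k ∈ D), ((k : ℝ≥0∞) + 1)

/-- The first outcome in `D`. -/
def firstAccepted (D : Set ℝ) (x : ℕ → ℝ) : ℝ :=
  x (sInf {k | x k ∈ D})

/-- The `M` filtered samples produced by rejection; `x i k` is the outcome of the `k`-th run made
to obtain the `i`-th filtered sample. -/
def filteredSamples (D : Set ℝ) {M : ℕ} (x : Fin M → ℕ → ℝ) : Fin M → ℝ :=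
  fun i => firstAccepted D (x i)

/-- The total number of circuit runs made to obtain `M` filtered samples by rejection. -/
def totalRuns (D : Set ℝ) {M : ℕ} (x : Fin M → ℕ → ℝ) : ℝ≥0∞ :=
  ∑ i, runsUntilAccept D (x i)

/-- The total number of calls to `U` if each circuit run makes `t` calls. -/
def totalCalls (t : ℕ) (D : Set ℝ) {M : ℕ} (x : Fin M → ℕ → ℝ) : ℝ≥0∞ :=
  t * totalRuns D x

/-- The filter interval of length `Δ` centred at `g`. -/
def filterInterval (g Δ : ℝ) : Set ℝ := Set.Icc (g - Δ / 2) (g + Δ / 2)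

end

end PhaseEstimation

namespace PhaseEstimation

open Real Set

/-! ### Truncated Gaussian weights -/

/-- The unnormalized Gaussian weight of width `σ` centred at `φ`. -/
noncomputable def gaussianWeight (σ φ y : ℝ) : ℝ := exp (-(y - φ) ^ 2 / (2 * σ ^ 2))

lemma gaussianWeight_pos (σ φ y : ℝ) : 0 < gaussianWeight σ φ y := exp_pos _

lemma continuous_gaussianWeight (σ φ : ℝ) : Continuous (gaussianWeight σ φ) := by
  unfold gaussianWeight; fun_prop

lemma integrableOn_mul_gaussianWeight {h : ℝ → ℝ} (hh : Continuous h) (σ φ a b : ℝ) :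
    IntegrableOn (fun y => h y * gaussianWeight σ φ y) (Icc a b) :=
  (hh.mul (continuous_gaussianWeight σ φ)).continuousOn.integrableOn_Icc

lemma integrableOn_gaussianWeight (σ φ a b : ℝ) :
    IntegrableOn (gaussianWeight σ φ) (Icc a b) :=
  (continuous_gaussianWeight σ φ).continuousOn.integrableOn_Icc

/-- The mass that the Gaussian weight centred at `φ` gives to `[a, b]`. -/
noncomputable def truncatedMass (σ a b φ : ℝ) : ℝ := ∫ y in Icc a b, gaussianWeight σ φ y

/-- The mean of the Gaussian centred at `φ` conditioned on `[a, b]`. -/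
noncomputable def truncatedMean (σ a b φ : ℝ) : ℝ :=
  (∫ y in Icc a b, y * gaussianWeight σ φ y) / truncatedMass σ a b φ

/-- The variance of the Gaussian centred at `φ` conditioned on `[a, b]`. -/
noncomputable def truncatedVariance (σ a b φ : ℝ) : ℝ :=
  (∫ y in Icc a b, (y - truncatedMean σ a b φ) ^ 2 * gaussianWeight σ φ y) / truncatedMass σ a b φ

lemma integrable_gaussianWeight {σ : ℝ} (hσ : 0 < σ) (φ : ℝ) :
    Integrable (gaussianWeight σ φ) := by
  have h := (integrable_exp_neg_mul_sq (b := 1 / (2 * σ ^ 2)) (by positivity)).comp_sub_right φ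
  refine h.congr (.of_forall fun y => ?_)
  simp only [gaussianWeight]; ring_nf

lemma integral_gaussianWeight {σ : ℝ} (hσ : 0 < σ) (φ : ℝ) :
    ∫ y, gaussianWeight σ φ y = σ * sqrt (2 * π) := by
  have h := integral_gaussian (1 / (2 * σ ^ 2))
  rw [← integral_sub_right_eq_self _ φ] at h
  have e : π / (1 / (2 * σ ^ 2)) = σ ^ 2 * (2 * π) := by field_simp
  rw [e, sqrt_mul (by positivity), sqrt_sq hσ.le] at h
  rw [← h]
  refine integral_congr_ae (.of_forall fun y => ?_)
  simp only [gaussianWeight]; ring_nf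

lemma integral_gaussianWeight_le {σ : ℝ} (hσ : 0 < σ) (φ : ℝ) :
    ∫ y, gaussianWeight σ φ y ≤ 3 * σ := by
  rw [integral_gaussianWeight hσ]
  have : sqrt (2 * π) ≤ 3 := by
    rw [sqrt_le_left (by norm_num)]; linarith [pi_lt_d2]
  nlinarith

lemma truncatedMass_le {σ : ℝ} (hσ : 0 < σ) (a b φ : ℝ) : truncatedMass σ a b φ ≤ 3 * σ :=
  (setIntegral_le_integral (integrable_gaussianWeight hσ φ)
    (.of_forall fun y => (gaussianWeight_pos σ φ y).le)).trans (integral_gaussianWeight_le hσ φ)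

lemma sq_mul_gaussianWeight_le {σ : ℝ} (hσ : 0 < σ) (φ y : ℝ) :
    (y - φ) ^ 2 * gaussianWeight σ φ y ≤ 4 * σ ^ 2 * exp (-(1 / (4 * σ ^ 2)) * (y - φ) ^ 2) := by
  have h1 : (y - φ) ^ 2 / (4 * σ ^ 2) ≤ exp ((y - φ) ^ 2 / (4 * σ ^ 2)) := by
    linarith [add_one_le_exp ((y - φ) ^ 2 / (4 * σ ^ 2))]
  have h2 : (y - φ) ^ 2 ≤ 4 * σ ^ 2 * exp ((y - φ) ^ 2 / (4 * σ ^ 2)) := by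
    rwa [div_le_iff₀' (by positivity)] at h1
  calc (y - φ) ^ 2 * gaussianWeight σ φ y
      ≤ 4 * σ ^ 2 * exp ((y - φ) ^ 2 / (4 * σ ^ 2)) * gaussianWeight σ φ y :=
        mul_le_mul_of_nonneg_right h2 (gaussianWeight_pos σ φ y).le
    _ = _ := by
        rw [gaussianWeight, mul_assoc, ← exp_add]; congr 2; field_simp; ring

lemma integral_sq_mul_gaussianWeight_le {σ : ℝ} (hσ : 0 < σ) (a b φ : ℝ) :
    ∫ y in Icc a b, (y - φ) ^ 2 * gaussianWeight σ φ y ≤ 16 * σ ^ 3 := by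
  have hb : 0 < 1 / (4 * σ ^ 2) := by positivity
  have hi : Integrable fun y : ℝ => 4 * σ ^ 2 * exp (-(1 / (4 * σ ^ 2)) * (y - φ) ^ 2) :=
    ((integrable_exp_neg_mul_sq hb).comp_sub_right φ).const_mul _
  have h := integral_gaussian (1 / (4 * σ ^ 2))
  rw [← integral_sub_right_eq_self _ φ] at h
  have e : π / (1 / (4 * σ ^ 2)) = σ ^ 2 * (4 * π) := by field_simp
  rw [e, sqrt_mul (by positivity), sqrt_sq hσ.le] at h
  have h4 : sqrt (4 * π) ≤ 4 := by
    rw [sqrt_le_left (by norm_num)]; linarith [pi_lt_d2]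
  calc ∫ y in Icc a b, (y - φ) ^ 2 * gaussianWeight σ φ y
      ≤ ∫ y in Icc a b, 4 * σ ^ 2 * exp (-(1 / (4 * σ ^ 2)) * (y - φ) ^ 2) :=
        setIntegral_mono (integrableOn_mul_gaussianWeight (by fun_prop) _ _ _ _)
          hi.integrableOn (fun y => sq_mul_gaussianWeight_le hσ φ y)
    _ ≤ ∫ y, 4 * σ ^ 2 * exp (-(1 / (4 * σ ^ 2)) * (y - φ) ^ 2) :=
        setIntegral_le_integral hi (.of_forall fun y => by positivity)
    _ = 4 * σ ^ 2 * (σ * sqrt (4 * π)) := by rw [integral_const_mul, h]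
    _ ≤ 4 * σ ^ 2 * (σ * 4) := by gcongr
    _ = 16 * σ ^ 3 := by ring

/-- An interval of length at least `2ℓ` contains a subinterval of length `ℓ` within distance `ℓ` of
any of its points. -/
lemma exists_Icc_subset_near {a b φ ℓ : ℝ} (hℓ : 0 ≤ ℓ) (hab : 2 * ℓ ≤ b - a) (hφ : φ ∈ Icc a b) :
    ∃ c, Icc c (c + ℓ) ⊆ Icc a b ∧ ∀ y ∈ Icc c (c + ℓ), |y - φ| ≤ ℓ := by
  rcases le_total (φ + ℓ) b with h | h
  · refine ⟨φ, fun y hy => ⟨hφ.1.trans hy.1, hy.2.trans h⟩, fun y hy => abs_le.2 ⟨?_, ?_⟩⟩ <;>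
      linarith [hy.1, hy.2]
  · refine ⟨φ - ℓ, fun y hy => ⟨?_, ?_⟩, fun y hy => abs_le.2 ⟨?_, ?_⟩⟩ <;>
      linarith [hy.1, hy.2, hφ.1, hφ.2]

lemma le_gaussianWeight {σ φ y ℓ : ℝ} (hσ : 0 < σ) (hℓσ : 2 * ℓ ≤ σ) (hy : |y - φ| ≤ ℓ) :
    7 / 8 ≤ gaussianWeight σ φ y := by
  have h1 : (y - φ) ^ 2 ≤ (σ / 2) ^ 2 := sq_le_sq' (by linarith [(abs_le.1 hy).1])
    (by linarith [(abs_le.1 hy).2])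
  have h2 : -(1 / 8) ≤ -(y - φ) ^ 2 / (2 * σ ^ 2) := by
    rw [le_div_iff₀ (by positivity)]; linarith
  have := add_one_le_exp (-(y - φ) ^ 2 / (2 * σ ^ 2))
  unfold gaussianWeight; linarith

/-- Integrals over `[a, b]` of a nonnegative function against the Gaussian weight are bounded below
by its integral near the centre. -/
lemma integral_Icc_le_integral_mul_gaussianWeight {σ φ a b c ℓ : ℝ} {h : ℝ → ℝ} (hσ : 0 < σ)
    (hℓσ : 2 * ℓ ≤ σ) (hsub : Icc c (c + ℓ) ⊆ Icc a b) (hc : ∀ y ∈ Icc c (c + ℓ), |y - φ| ≤ ℓ)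
    (hh : Continuous h) (h0 : ∀ y, 0 ≤ h y) :
    7 / 8 * ∫ y in Icc c (c + ℓ), h y ≤ ∫ y in Icc a b, h y * gaussianWeight σ φ y := by
  rw [← integral_const_mul]
  calc ∫ y in Icc c (c + ℓ), 7 / 8 * h y ≤ ∫ y in Icc c (c + ℓ), h y * gaussianWeight σ φ y := by
        refine setIntegral_mono_on (hh.continuousOn.integrableOn_Icc.const_mul _)
          (integrableOn_mul_gaussianWeight hh _ _ _ _) measurableSet_Icc fun y hy => ?_
        rw [mul_comm]
        exact mul_le_mul_of_nonneg_left (le_gaussianWeight hσ hℓσ (hc y hy)) (h0 y)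
    _ ≤ _ := setIntegral_mono_set (integrableOn_mul_gaussianWeight hh _ _ _ _)
        (.of_forall fun y => mul_nonneg (h0 y) (gaussianWeight_pos _ _ _).le)
        hsub.eventuallyLE

lemma le_truncatedMass {σ a b φ ℓ : ℝ} (hσ : 0 < σ) (hℓ : 0 ≤ ℓ) (hℓσ : 2 * ℓ ≤ σ)
    (hab : 2 * ℓ ≤ b - a) (hφ : φ ∈ Icc a b) : 7 / 8 * ℓ ≤ truncatedMass σ a b φ := by
  obtain ⟨c, hsub, hc⟩ := exists_Icc_subset_near hℓ hab hφ
  have h := integral_Icc_le_integral_mul_gaussianWeight (h := fun _ => 1) hσ hℓσ hsub hc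
    continuous_const (fun _ => zero_le_one)
  simpa [truncatedMass, hℓ] using h

lemma integral_Icc_sub_sq_ge {c ℓ : ℝ} (hℓ : 0 ≤ ℓ) (m : ℝ) :
    ℓ ^ 3 / 12 ≤ ∫ y in Icc c (c + ℓ), (y - m) ^ 2 := by
  rw [integral_Icc_eq_integral_Ioc, ← intervalIntegral.integral_of_le (by linarith),
    intervalIntegral.integral_comp_sub_right (fun y => y ^ 2), integral_pow]
  norm_num
  nlinarith [mul_nonneg hℓ (sq_nonneg (c - m + ℓ / 2))]

lemma le_truncatedVariance {σ a b φ ℓ : ℝ} (hσ : 0 < σ) (hℓ : 0 < ℓ) (hℓσ : 2 * ℓ ≤ σ)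
    (hab : 2 * ℓ ≤ b - a) (hφ : φ ∈ Icc a b) :
    7 * ℓ ^ 3 / (288 * σ) ≤ truncatedVariance σ a b φ := by
  obtain ⟨c, hsub, hc⟩ := exists_Icc_subset_near hℓ.le hab hφ
  have h := integral_Icc_le_integral_mul_gaussianWeight
    (h := fun y => (y - truncatedMean σ a b φ) ^ 2) hσ hℓσ hsub hc (by fun_prop)
    (fun _ => sq_nonneg _)
  have h1 := integral_Icc_sub_sq_ge (c := c) hℓ.le (truncatedMean σ a b φ)
  have h2 := le_truncatedMass hσ hℓ.le hℓσ hab hφ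
  have h3 := truncatedMass_le hσ a b φ
  have hm : 0 < truncatedMass σ a b φ := by linarith
  rw [truncatedVariance, div_le_div_iff₀ (by positivity) hm]
  calc 7 * ℓ ^ 3 * truncatedMass σ a b φ ≤ 7 * ℓ ^ 3 * (3 * σ) := by gcongr
    _ = 7 / 8 * (ℓ ^ 3 / 12) * (288 * σ) := by ring
    _ ≤ _ := by gcongr; linarith

/-! ### The log-partition function -/

/-- The centred Gaussian weight on `[a, b]`, as a measure. -/
noncomputable def truncatedGaussian (σ a b : ℝ) : Measure ℝ :=
  (volume.restrict (Icc a b)).withDensity fun y => ENNReal.ofReal (gaussianWeight σ 0 y)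

instance (σ a b : ℝ) : IsFiniteMeasure (truncatedGaussian σ a b) :=
  isFiniteMeasure_withDensity_ofReal (integrableOn_gaussianWeight σ 0 a b).2

lemma integral_truncatedGaussian (σ a b : ℝ) (h : ℝ → ℝ) :
    ∫ y, h y ∂truncatedGaussian σ a b = ∫ y in Icc a b, gaussianWeight σ 0 y * h y := by
  rw [truncatedGaussian, integral_withDensity_eq_integral_toReal_smul
    (by have := (continuous_gaussianWeight σ 0).measurable; fun_prop) (by simp)]
  simp [ENNReal.toReal_ofReal (gaussianWeight_pos _ _ _).le]

lemma gaussianWeight_zero_mul_exp {σ : ℝ} (hσ : 0 < σ) (φ y : ℝ) :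
    gaussianWeight σ 0 y * exp (φ / σ ^ 2 * y) =
      exp (φ ^ 2 / (2 * σ ^ 2)) * gaussianWeight σ φ y := by
  simp only [gaussianWeight, ← exp_add]
  congr 1; field_simp; ring

lemma integral_truncatedGaussian_mul_exp {σ : ℝ} (hσ : 0 < σ) (a b φ : ℝ) (h : ℝ → ℝ) :
    ∫ y, h y * exp (φ / σ ^ 2 * y) ∂truncatedGaussian σ a b =
      exp (φ ^ 2 / (2 * σ ^ 2)) * ∫ y in Icc a b, h y * gaussianWeight σ φ y := by
  rw [integral_truncatedGaussian, ← integral_const_mul]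
  congr 1 with y
  linear_combination h y * gaussianWeight_zero_mul_exp hσ φ y

lemma mgf_truncatedGaussian {σ : ℝ} (hσ : 0 < σ) (a b φ : ℝ) :
    mgf id (truncatedGaussian σ a b) (φ / σ ^ 2) =
      exp (φ ^ 2 / (2 * σ ^ 2)) * truncatedMass σ a b φ := by
  have := integral_truncatedGaussian_mul_exp hσ a b φ (fun _ => 1)
  simpa [mgf, truncatedMass] using this

lemma integrableExpSet_truncatedGaussian (σ a b : ℝ) :
    integrableExpSet id (truncatedGaussian σ a b) = univ := by
  refine eq_univ_of_forall fun s => ?_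
  have hD : ∀ᵐ y ∂truncatedGaussian σ a b, y ∈ Icc a b :=
    withDensity_absolutelyContinuous _ _ (ae_restrict_mem measurableSet_Icc)
  obtain ⟨K, hK⟩ := isCompact_Icc.exists_bound_of_continuousOn (s := Icc a b)
    (f := fun y => exp (s * id y)) (by fun_prop)
  exact .of_bound (by fun_prop) K (hD.mono fun y hy => hK y hy)

lemma mem_interior_integrableExpSet_truncatedGaussian (σ a b s : ℝ) :
    s ∈ interior (integrableExpSet id (truncatedGaussian σ a b)) := by
  simp [integrableExpSet_truncatedGaussian]

lemma deriv_cgf_truncatedGaussian {σ : ℝ} (hσ : 0 < σ) (a b φ : ℝ) :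
    deriv (cgf id (truncatedGaussian σ a b)) (φ / σ ^ 2) = truncatedMean σ a b φ := by
  rw [deriv_cgf (mem_interior_integrableExpSet_truncatedGaussian ..), mgf_truncatedGaussian hσ]
  simp only [id]
  rw [integral_truncatedGaussian_mul_exp hσ a b φ (fun y => y),
    mul_div_mul_left _ _ (exp_pos _).ne', truncatedMean]

lemma iteratedDeriv_two_cgf_truncatedGaussian {σ : ℝ} (hσ : 0 < σ) (a b φ : ℝ) :
    iteratedDeriv 2 (cgf id (truncatedGaussian σ a b)) (φ / σ ^ 2) =
      truncatedVariance σ a b φ := by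
  rw [iteratedDeriv_two_cgf_eq_integral (mem_interior_integrableExpSet_truncatedGaussian ..),
    mgf_truncatedGaussian hσ, deriv_cgf_truncatedGaussian hσ]
  simp only [id]
  rw [integral_truncatedGaussian_mul_exp hσ a b φ (fun y => (y - truncatedMean σ a b φ) ^ 2),
    mul_div_mul_left _ _ (exp_pos _).ne', truncatedVariance]

lemma hasDerivAt_truncatedMean {σ : ℝ} (hσ : 0 < σ) (a b φ : ℝ) :
    HasDerivAt (truncatedMean σ a b) (truncatedVariance σ a b φ / σ ^ 2) φ := by
  have hA := analyticAt_cgf (mem_interior_integrableExpSet_truncatedGaussian σ a b (φ / σ ^ 2))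
  have h1 := hA.deriv.differentiableAt.hasDerivAt
  have h2 : deriv (deriv (cgf id (truncatedGaussian σ a b))) (φ / σ ^ 2) =
      truncatedVariance σ a b φ := by
    rw [← iteratedDeriv_two_cgf_truncatedGaussian hσ, iteratedDeriv_succ, iteratedDeriv_one]
  rw [h2] at h1
  have h3 := h1.comp φ ((hasDerivAt_id φ).div_const (σ ^ 2))
  have e : deriv (cgf id (truncatedGaussian σ a b)) ∘ (fun x => id x / σ ^ 2) =
      truncatedMean σ a b := by
    ext x; exact deriv_cgf_truncatedGaussian hσ a b x
  rw [e] at h3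
  exact h3.congr_deriv (by ring)

/-- Up to a term that does not depend on `φ`, the log-likelihood of samples with mean `s`. -/
noncomputable def meanLogLikelihood (σ a b s φ : ℝ) : ℝ :=
  s * (φ / σ ^ 2) - cgf id (truncatedGaussian σ a b) (φ / σ ^ 2)

lemma hasDerivAt_meanLogLikelihood {σ : ℝ} (hσ : 0 < σ) (a b s φ : ℝ) :
    HasDerivAt (meanLogLikelihood σ a b s) ((s - truncatedMean σ a b φ) / σ ^ 2) φ := by
  have h1 := (analyticAt_cgf (mem_interior_integrableExpSet_truncatedGaussian σ a b
    (φ / σ ^ 2))).differentiableAt.hasDerivAt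
  rw [deriv_cgf_truncatedGaussian hσ] at h1
  have h0 := (hasDerivAt_id φ).div_const (σ ^ 2)
  have h3 := (h0.const_mul s).sub (h1.comp φ h0)
  exact h3.congr_deriv (by ring)

lemma mul_sub_sq_le_truncatedMean {σ a b c φ₁ φ₂ : ℝ} (hσ : 0 < σ)
    (hc : ∀ φ ∈ Icc a b, c ≤ truncatedVariance σ a b φ / σ ^ 2) (h₁ : φ₁ ∈ Icc a b)
    (h₂ : φ₂ ∈ Icc a b) :
    c * (φ₂ - φ₁) ^ 2 ≤ (truncatedMean σ a b φ₂ - truncatedMean σ a b φ₁) * (φ₂ - φ₁) := by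
  have hmono : MonotoneOn (fun φ => truncatedMean σ a b φ - c * φ) (Icc a b) := by
    have hd : ∀ φ, HasDerivAt (fun φ => truncatedMean σ a b φ - c * φ)
        (truncatedVariance σ a b φ / σ ^ 2 - c) φ := fun φ => by
      exact ((hasDerivAt_truncatedMean hσ a b φ).sub ((hasDerivAt_id φ).const_mul c)).congr_deriv
        (by ring)
    refine monotoneOn_of_deriv_nonneg (convex_Icc a b)
      (fun φ _ => (hd φ).continuousAt.continuousWithinAt)
      (fun φ _ => (hd φ).differentiableAt.differentiableWithinAt) fun φ hφ => ?_
    rw [(hd φ).deriv]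
    linarith [hc φ (interior_subset hφ)]
  rcases le_total φ₁ φ₂ with h | h
  · nlinarith [hmono h₁ h₂ h]
  · nlinarith [hmono h₂ h₁ h]

lemma exists_pos_le_truncatedVariance_div {σ a b : ℝ} (hσ : 0 < σ) (hab : a < b) :
    ∃ c > 0, ∀ φ ∈ Icc a b, c ≤ truncatedVariance σ a b φ / σ ^ 2 := by
  have hℓ : 0 < min σ (b - a) / 2 := by have := lt_min hσ (sub_pos.2 hab); linarith
  refine ⟨7 * (min σ (b - a) / 2) ^ 3 / (288 * σ) / σ ^ 2, by positivity, fun φ hφ => ?_⟩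
  gcongr
  exact le_truncatedVariance hσ hℓ (by linarith [min_le_left σ (b - a)])
    (by linarith [min_le_right σ (b - a)]) hφ

/-- First-order condition at a constrained maximizer. -/
lemma IsMaxOn.truncatedMean_variational {σ a b s φ φ' : ℝ} (hσ : 0 < σ) (hφ : φ ∈ Icc a b)
    (hmax : IsMaxOn (meanLogLikelihood σ a b s) (Icc a b) φ) (hφ' : φ' ∈ Icc a b) :
    (s - truncatedMean σ a b φ) * (φ' - φ) ≤ 0 := by
  have hd := (hasDerivAt_meanLogLikelihood hσ a b s φ).hasDerivWithinAt (s := Icc a b)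
  have h := hmax.localize.hasFDerivWithinAt_nonpos hd.hasFDerivWithinAt
    (sub_mem_posTangentConeAt_of_segment_subset ((convex_Icc a b).segment_subset hφ hφ'))
  simp only [ContinuousLinearMap.toSpanSingleton_apply, smul_eq_mul] at h
  have h2 : (φ' - φ) * ((s - truncatedMean σ a b φ) / σ ^ 2) * σ ^ 2 ≤ 0 :=
    mul_nonpos_of_nonpos_of_nonneg h (by positivity)
  rw [mul_assoc, div_mul_cancel₀ _ (by positivity)] at h2
  linarith

/-- The error of a constrained maximizer is controlled by the error of the sample mean. -/
lemma IsMaxOn.mul_abs_sub_le {σ a b c s φ φ₀ : ℝ} (hσ : 0 < σ)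
    (hc : ∀ φ ∈ Icc a b, c ≤ truncatedVariance σ a b φ / σ ^ 2) (hφ : φ ∈ Icc a b)
    (hmax : IsMaxOn (meanLogLikelihood σ a b s) (Icc a b) φ) (hφ₀ : φ₀ ∈ Icc a b) :
    c * |φ - φ₀| ≤ |s - truncatedMean σ a b φ₀| := by
  have h1 := IsMaxOn.truncatedMean_variational hσ hφ hmax hφ₀
  have h2 := mul_sub_sq_le_truncatedMean hσ hc hφ₀ hφ
  rcases eq_or_ne φ φ₀ with rfl | hne
  · simp
  have hpos : 0 < |φ - φ₀| := abs_pos.2 (sub_ne_zero.2 hne)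
  have h3 : c * |φ - φ₀| * |φ - φ₀| ≤ |s - truncatedMean σ a b φ₀| * |φ - φ₀| := by
    rw [mul_assoc, abs_mul_abs_self, ← abs_mul]
    refine le_trans ?_ (le_abs_self _)
    nlinarith
  exact le_of_mul_le_mul_right h3 hpos

lemma existsUnique_isMaxOn_meanLogLikelihood {σ a b : ℝ} (hσ : 0 < σ) (hab : a < b) (s : ℝ) :
    ∃! φ, φ ∈ Icc a b ∧ IsMaxOn (meanLogLikelihood σ a b s) (Icc a b) φ := by
  obtain ⟨φ, hφ, hmax⟩ := isCompact_Icc.exists_isMaxOn (nonempty_Icc.2 hab.le)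
    (f := meanLogLikelihood σ a b s)
    (fun φ _ => (hasDerivAt_meanLogLikelihood hσ a b s φ).continuousAt.continuousWithinAt)
  refine ⟨φ, ⟨hφ, hmax⟩, fun φ' ⟨hφ', hmax'⟩ => ?_⟩
  obtain ⟨c, hc0, hc⟩ := exists_pos_le_truncatedVariance_div hσ hab
  have h1 := IsMaxOn.truncatedMean_variational hσ hφ hmax hφ'
  have h2 := IsMaxOn.truncatedMean_variational hσ hφ' hmax' hφ
  have h3 := mul_sub_sq_le_truncatedMean hσ hc hφ hφ'
  have h4 : (φ' - φ) ^ 2 ≤ 0 := by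
    by_contra! h
    nlinarith [mul_pos hc0 h]
  exact sub_eq_zero.1 (pow_eq_zero_iff two_ne_zero |>.1 (le_antisymm h4 (sq_nonneg _)))

/-- The constrained maximizer as a function of the sample mean. -/
noncomputable def meanEstimator (σ a b : ℝ) (s : ℝ) : ℝ :=
  Classical.epsilon fun φ => φ ∈ Icc a b ∧ IsMaxOn (meanLogLikelihood σ a b s) (Icc a b) φ

lemma meanEstimator_spec {σ a b : ℝ} (hσ : 0 < σ) (hab : a < b) (s : ℝ) :
    meanEstimator σ a b s ∈ Icc a b ∧
      IsMaxOn (meanLogLikelihood σ a b s) (Icc a b) (meanEstimator σ a b s) :=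
  Classical.epsilon_spec (existsUnique_isMaxOn_meanLogLikelihood hσ hab s).exists

lemma monotone_meanEstimator {σ a b : ℝ} (hσ : 0 < σ) (hab : a < b) :
    Monotone (meanEstimator σ a b) := by
  intro s s' hs
  obtain ⟨hm, hmax⟩ := meanEstimator_spec hσ hab s
  obtain ⟨hm', hmax'⟩ := meanEstimator_spec hσ hab s'
  rcases hs.eq_or_lt with rfl | hs
  · rfl
  have h1 := hmax hm'
  have h2 := hmax' hm
  simp only [meanLogLikelihood, mem_ofPred_eq] at h1 h2
  have h3 : 0 ≤ (s' - s) * ((meanEstimator σ a b s' - meanEstimator σ a b s) / σ ^ 2) := by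
    rw [sub_div]; linarith
  have h4 := nonneg_of_mul_nonneg_right h3 (sub_pos.2 hs)
  have h5 := mul_nonneg h4 (sq_nonneg σ)
  rw [div_mul_cancel₀ _ (by positivity)] at h5
  linarith

/-! ### Rejection sampling -/

section Rejection

variable {Ω : Type*} [MeasurableSpace Ω] {μ : Measure Ω} {P : Measure ℝ} {D : Set ℝ}

lemma measurable_firstAcceptedIndex (hD : MeasurableSet D) :
    Measurable fun x : ℕ → ℝ => sInf {k | x k ∈ D} := by
  refine measurable_to_countable' fun n => ?_
  have hm : ∀ k, MeasurableSet {x : ℕ → ℝ | x k ∈ D} := fun k => measurable_pi_apply k hD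
  have e : (fun x : ℕ → ℝ => sInf {k | x k ∈ D}) ⁻¹' {n} =
      ({x | x n ∈ D} ∩ ⋂ l, ⋂ _ : l < n, {x | x l ∈ D}ᶜ) ∪
        (⋂ l, {x | x l ∈ D}ᶜ) ∩ {_x | n = 0} := by
    ext x
    simp only [mem_preimage, mem_singleton_iff, mem_union, mem_inter_iff, mem_iInter,
      mem_compl_iff, mem_ofPred_eq]
    constructor
    · rintro rfl
      by_cases h : {k | x k ∈ D}.Nonempty
      · exact .inl ⟨Nat.sInf_mem h, fun l hl => Nat.notMem_of_lt_sInf hl⟩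
      · rw [not_nonempty_iff_eq_empty] at h
        refine .inr ⟨fun l hl => ?_, by simp [h]⟩
        exact (h ▸ hl : l ∈ (∅ : Set ℕ))
    · rintro (⟨h1, h2⟩ | ⟨h1, rfl⟩)
      · refine le_antisymm (Nat.sInf_le h1) (not_lt.1 fun hlt => h2 _ hlt 
          (Nat.sInf_mem (s := {k | x k ∈ D}) ⟨n, h1⟩))
      · have : {k | x k ∈ D} = ∅ := eq_empty_of_forall_notMem h1
        simp [this]
  rw [e]
  exact ((hm n).inter (.iInter fun l => .iInter fun _ => (hm l).compl)).union
    ((MeasurableSet.iInter fun l => (hm l).compl).inter (.const _))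

lemma measurable_firstAccepted (hD : MeasurableSet D) : Measurable (firstAccepted D) := by
  have h : Measurable fun p : ℕ × (ℕ → ℝ) => p.2 p.1 :=
    measurable_from_prod_countable_right fun k => measurable_pi_apply k
  exact h.comp ((measurable_firstAcceptedIndex hD).prodMk measurable_id)

lemma measure_rejected_inter [IsProbabilityMeasure P] (hD : MeasurableSet D) {X : ℕ → Ω → ℝ}
    (hX : ∀ k, Measurable (X k)) (hlaw : ∀ k, HasLaw (X k) P μ) (hind : iIndepFun X μ) (k : ℕ)
    {S : Set ℝ} (hS : MeasurableSet S) :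
    μ ((⋂ l ∈ Finset.range k, X l ⁻¹' Dᶜ) ∩ X k ⁻¹' S) = (1 - P D) ^ k * P S := by
  have h := hind.measure_inter_preimage_eq_mul (Finset.range (k + 1))
    (sets := fun l => if l = k then S else Dᶜ)
    (fun l _ => by split_ifs; exacts [hS, hD.compl])
  have hl : ∀ {l} {T : Set ℝ}, MeasurableSet T → μ (X l ⁻¹' T) = P T := fun {l T} hT => by
    rw [← (hlaw l).map_eq, Measure.map_apply (hX l) hT]
  rw [Finset.prod_range_succ, if_pos rfl, hl hS,
    Finset.prod_congr rfl (g := fun _ => 1 - P D)] at h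
  · rw [Finset.prod_const, Finset.card_range] at h
    rw [← h]
    congr 1
    ext ω
    simp only [mem_inter_iff, mem_iInter, Finset.mem_range, mem_preimage]
    constructor
    · rintro ⟨h1, h2⟩ l hl
      split_ifs with e
      · exact e ▸ h2
      · exact h1 l (by omega)
    · intro h
      refine ⟨fun l hl => ?_, ?_⟩
      · have := h l (by omega)
        rwa [if_neg (by omega)] at this
      · simpa using h k (by omega)
  · intro l hlk
    rw [if_neg (Finset.mem_range.1 hlk).ne, hl hD.compl, prob_compl_eq_one_sub hD]

lemma tsum_one_sub_measure_pow [IsProbabilityMeasure P] :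
    ∑' k : ℕ, (1 - P D) ^ k = (P D)⁻¹ := by
  rw [ENNReal.tsum_geometric, ENNReal.sub_sub_cancel (by simp) prob_le_one]

lemma runsUntilAccept_le_tsum (x : ℕ → ℝ) :
    runsUntilAccept D x ≤
      ∑' k : ℕ, {y : ℕ → ℝ | ∀ l < k, y l ∉ D}.indicator (fun _ => (1 : ℝ≥0∞)) x := by
  by_cases h : ∃ k, x k ∈ D
  · classical
    let n := Nat.find h
    calc runsUntilAccept D x ≤ (n : ℝ≥0∞) + 1 := iInf₂_le n (Nat.find_spec h)
      _ = ∑ k ∈ Finset.range (n + 1),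
          {y : ℕ → ℝ | ∀ l < k, y l ∉ D}.indicator (fun _ => (1 : ℝ≥0∞)) x := by
          rw [Finset.sum_congr rfl (g := fun _ => 1)]
          · simp
          · intro k hk
            have hx : x ∈ {y : ℕ → ℝ | ∀ l < k, y l ∉ D} := fun l hl =>
              Nat.find_min h (hl.trans_le (Nat.lt_succ_iff.1 (Finset.mem_range.1 hk)))
            exact indicator_of_mem hx _
      _ ≤ _ := ENNReal.sum_le_tsum _
  · push Not at h
    have : ∀ k : ℕ, {y : ℕ → ℝ | ∀ l < k, y l ∉ D}.indicator (fun _ => (1 : ℝ≥0∞)) x = 1 :=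
      fun k => indicator_of_mem (mem_ofPred_eq ▸ fun l _ => h l) _
    simp [this]

/-- The expected number of runs until the first acceptance. -/
lemma lintegral_runsUntilAccept_le [IsProbabilityMeasure P] (hD : MeasurableSet D)
    {X : ℕ → Ω → ℝ} (hX : ∀ k, Measurable (X k)) (hlaw : ∀ k, HasLaw (X k) P μ)
    (hind : iIndepFun X μ) :
    ∫⁻ ω, runsUntilAccept D (fun k => X k ω) ∂μ ≤ (P D)⁻¹ := by
  have hset : ∀ k : ℕ, (fun ω => fun k => X k ω) ⁻¹' {y : ℕ → ℝ | ∀ l < k, y l ∉ D} =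
      (⋂ l ∈ Finset.range k, X l ⁻¹' Dᶜ) := fun k => by
    ext ω; simp
  have hmeas : ∀ k : ℕ, MeasurableSet (⋂ l ∈ Finset.range k, X l ⁻¹' Dᶜ) := fun k =>
    Finset.measurableSet_biInter _ fun l _ => hX l hD.compl
  calc ∫⁻ ω, runsUntilAccept D (fun k => X k ω) ∂μ
      ≤ ∫⁻ ω, ∑' k : ℕ, (⋂ l ∈ Finset.range k, X l ⁻¹' Dᶜ).indicator (fun _ => (1 : ℝ≥0∞)) ω ∂μ := by
        refine lintegral_mono fun ω => (runsUntilAccept_le_tsum _).trans_eq ?_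
        congr 1 with k
        rw [← hset k]; rfl
    _ = ∑' k : ℕ, (1 - P D) ^ k := by
        rw [lintegral_tsum fun k => (measurable_const.indicator (hmeas k)).aemeasurable]
        congr 1 with k
        rw [lintegral_indicator_const (hmeas k), one_mul]
        have := measure_rejected_inter hD hX hlaw hind k MeasurableSet.univ
        simpa using this
    _ = (P D)⁻¹ := tsum_one_sub_measure_pow

/-- The first accepted outcome is distributed according to the conditional law. -/
lemma hasLaw_firstAccepted [IsProbabilityMeasure μ] [IsProbabilityMeasure P]
    (hD : MeasurableSet D) (hPD : P D ≠ 0)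
    {X : ℕ → Ω → ℝ} (hX : ∀ k, Measurable (X k)) (hlaw : ∀ k, HasLaw (X k) P μ)
    (hind : iIndepFun X μ) :
    HasLaw (fun ω => firstAccepted D fun k => X k ω) (P[|D]) μ := by
  have hm : Measurable fun ω => firstAccepted D fun k => X k ω :=
    (measurable_firstAccepted hD).comp (measurable_pi_iff.2 hX)
  refine ⟨hm.aemeasurable, ?_⟩
  have := Measure.isProbabilityMeasure_map (μ := μ) hm.aemeasurable
  have := cond_isProbabilityMeasure (μ := P) (s := D) hPD
  refine (Measure.eq_of_le_of_isProbabilityMeasure (Measure.le_iff.2 fun S hS => ?_)).symm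
  rw [cond_apply hD, Measure.map_apply hm hS, ← tsum_one_sub_measure_pow (P := P),
    ← ENNReal.tsum_mul_right]
  simp_rw [← measure_rejected_inter hD hX hlaw hind _ (hD.inter hS)]
  rw [← measure_iUnion]
  · refine measure_mono (iUnion_subset fun k ω ⟨h1, h2⟩ => ?_)
    have hk : sInf {j | X j ω ∈ D} = k := by
      refine le_antisymm (Nat.sInf_le h2.1) (not_lt.1 fun hlt => ?_)
      have h3 := mem_iInter₂.1 h1 _ (Finset.mem_range.2 hlt)
      exact h3 (Nat.sInf_mem (s := {j | X j ω ∈ D}) ⟨k, h2.1⟩)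
    simp only [mem_preimage, firstAccepted, hk]
    exact h2.2
  · intro k k' hne
    refine Set.disjoint_left.2 fun ω h h' => ?_
    rcases hne.lt_or_gt with hlt | hlt
    · exact mem_iInter₂.1 h'.1 k (Finset.mem_range.2 hlt) h.2.1
    · exact mem_iInter₂.1 h.1 k' (Finset.mem_range.2 hlt) h'.2.1
  · exact fun k => (Finset.measurableSet_biInter _ fun l _ => hX l hD.compl).inter
      (hX k (hD.inter hS))

/-- First accepted outcomes of disjoint blocks of runs are independent. -/
lemma indepFun_firstAccepted {ι : Type*} (hD : MeasurableSet D)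
    {X : ι → ℕ → Ω → ℝ} (hX : ∀ i k, Measurable (X i k))
    (hind : iIndepFun (fun p : ι × ℕ => X p.1 p.2) μ) {i j : ι} (hij : i ≠ j) :
    IndepFun (fun ω => firstAccepted D fun k => X i k ω)
      (fun ω => firstAccepted D fun k => X j k ω) μ := by
  let m : ι × ℕ → MeasurableSpace Ω := fun p => MeasurableSpace.comap (X p.1 p.2) inferInstance
  have hsub : ∀ i, MeasurableSpace.comap (fun ω => firstAccepted D fun k => X i k ω) inferInstance ≤
      ⨆ p ∈ {p : ι × ℕ | p.1 = i}, m p := fun i => by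
    have e : (fun ω => firstAccepted D fun k => X i k ω) =
      firstAccepted D ∘ fun ω k => X i k ω := rfl
    rw [e, ← MeasurableSpace.comap_comp]
    refine (MeasurableSpace.comap_mono (measurable_firstAccepted hD).comap_le).trans ?_
    rw [MeasurableSpace.pi, MeasurableSpace.comap_iSup]
    refine iSup_le fun k => ?_
    rw [MeasurableSpace.comap_comp]
    have hk : (i, k) ∈ {p : ι × ℕ | p.1 = i} := rfl
    exact le_iSup₂ (f := fun (p : ι × ℕ) (_ : p ∈ {p : ι × ℕ | p.1 = i}) => m p) (i, k) hk
  have hdisj : Disjoint {p : ι × ℕ | p.1 = i} {p : ι × ℕ | p.1 = j} :=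
    Set.disjoint_left.2 fun p hp hq => hij (hp.symm.trans hq)
  have h : Indep (⨆ p ∈ {p : ι × ℕ | p.1 = i}, m p) (⨆ p ∈ {p : ι × ℕ | p.1 = j}, m p) μ :=
    indep_iSup_of_disjoint (m := m) (fun p => (hX p.1 p.2).comap_le) hind hdisj
  exact indep_of_indep_of_le_left (indep_of_indep_of_le_right h (hsub j)) (hsub i)

/-- The mean square error of the empirical mean of pairwise independent samples. -/
lemma integral_sq_empiricalMean_sub [IsProbabilityMeasure μ] {a b : ℝ} {M : ℕ} (hM : 1 ≤ M)
    (hP : ∀ᵐ y ∂P, y ∈ Icc a b) {Y : Fin M → Ω → ℝ} (hlaw : ∀ i, HasLaw (Y i) P μ)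
    (hind : Pairwise fun i j => IndepFun (Y i) (Y j) μ) (m : ℝ) :
    Integrable (fun ω => (1 / (M : ℝ) * ∑ i, Y i ω - m) ^ 2) μ ∧
    ∫ ω, (1 / (M : ℝ) * ∑ i, Y i ω - m) ^ 2 ∂μ = Var[id; P] / M + (∫ y, y ∂P - m) ^ 2 := by
  have hmem : ∀ i, MemLp (Y i) 2 μ := fun i => by
    refine MemLp.of_bound (hlaw i).aemeasurable.aestronglyMeasurable (max |a| |b|) ?_
    have : ∀ᵐ ω ∂μ, Y i ω ∈ Icc a b :=
      ((hlaw i).ae_iff (p := fun y => y ∈ Icc a b) (measurableSet_Icc.mem)).2 hP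
    filter_upwards [this] with ω hω
    exact abs_le_max_abs_abs hω.1 hω.2
  have hM0 : (M : ℝ) ≠ 0 := by positivity
  have hsum : MemLp (∑ i, Y i) 2 μ := memLp_finsetSum' _ fun i _ => hmem i
  have hbar : MemLp (fun ω => 1 / (M : ℝ) * (∑ i, Y i) ω - m) 2 μ :=
    (hsum.const_mul _).sub (memLp_const m)
  have hvar : Var[fun ω => 1 / (M : ℝ) * (∑ i, Y i) ω - m; μ] = Var[id; P] / M := by
    rw [variance_sub_const (hsum.const_mul _).aestronglyMeasurable, variance_const_mul,
      IndepFun.variance_sum (fun i _ => hmem i) (fun i _ j _ hij => hind hij)]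
    simp_rw [fun i => (hlaw i).variance_eq]
    simp
    field_simp
  have hmean : ∫ ω, (1 / (M : ℝ) * (∑ i, Y i) ω - m) ∂μ = ∫ y, y ∂P - m := by
    rw [integral_sub ((hsum.integrable one_le_two).const_mul _) (integrable_const _),
      integral_const_mul]
    simp only [Finset.sum_apply]
    rw [integral_finsetSum _ fun i _ => (hmem i).integrable one_le_two]
    simp_rw [fun i => (hlaw i).integral_eq]
    simp
    field_simp
  have h := variance_eq_sub hbar
  rw [hvar, hmean] at h
  simp only [Finset.sum_apply] at hbar h
  refine ⟨hbar.integrable_sq, ?_⟩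
  have e : (fun ω => 1 / (M : ℝ) * ∑ i, Y i ω - m) ^ 2 =
    fun ω => (1 / (M : ℝ) * ∑ i, Y i ω - m) ^ 2 := rfl
  rw [e] at h
  linarith

/-- Expected cost, law and independence of the samples obtained by rejection. -/
lemma rejectionSampling [IsProbabilityMeasure μ] [IsProbabilityMeasure P] (hD : MeasurableSet D)
    (hPD : P D ≠ 0) {M : ℕ} {X : Fin M → ℕ → Ω → ℝ} (hlaw : ∀ i k, HasLaw (X i k) P μ)
    (hind : iIndepFun (fun p : Fin M × ℕ => X p.1 p.2) μ) :
    ∫⁻ ω, totalRuns D (fun i k => X i k ω) ∂μ ≤ M * (P D)⁻¹ ∧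
    (∀ i, HasLaw (fun ω => filteredSamples D (fun i k => X i k ω) i) (P[|D]) μ) ∧
    Pairwise fun i j => IndepFun (fun ω => filteredSamples D (fun i k => X i k ω) i)
      (fun ω => filteredSamples D (fun i k => X i k ω) j) μ := by
  let X' : Fin M → ℕ → Ω → ℝ := fun i k => (hlaw i k).aemeasurable.mk
  have hX' : ∀ i k, Measurable (X' i k) := fun i k => (hlaw i k).aemeasurable.measurable_mk
  have hae : ∀ i k, X i k =ᵐ[μ] X' i k := fun i k => (hlaw i k).aemeasurable.ae_eq_mk
  have hlaw' : ∀ i k, HasLaw (X' i k) P μ := fun i k => (hlaw i k).congr (hae i k).symm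
  have hind' : iIndepFun (fun p : Fin M × ℕ => X' p.1 p.2) μ := hind.congr fun p => hae p.1 p.2
  have hseq : ∀ i, (fun ω k => X i k ω) =ᵐ[μ] fun ω k => X' i k ω := fun i => by
    filter_upwards [ae_all_iff.2 (hae i)] with ω hω
    exact funext hω
  have hrow : ∀ i, iIndepFun (X' i) μ := fun i =>
    hind'.precomp (g := fun k : ℕ => (i, k)) (fun k l h => (Prod.mk.inj h).2)
  have hY : ∀ i, (fun ω => filteredSamples D (fun i k => X i k ω) i) =ᵐ[μ]
      fun ω => firstAccepted D fun k => X' i k ω := fun i =>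
    (hseq i).fun_comp (firstAccepted D)
  refine ⟨?_, fun i => (hasLaw_firstAccepted hD hPD (hX' i) (hlaw' i) (hrow i)).congr (hY i),
    fun i j hij => (indepFun_firstAccepted hD hX' hind' hij).congr (hY i).symm (hY j).symm⟩
  have hruns : ∀ᵐ ω ∂μ, totalRuns D (fun i k => X i k ω) =
      ∑ i, runsUntilAccept D (fun k => X' i k ω) := by
    filter_upwards [ae_all_iff.2 hseq] with ω hω
    exact Finset.sum_congr rfl fun i _ => by rw [← hω i]
  have hmeas : ∀ i, Measurable fun ω => runsUntilAccept D (fun k => X' i k ω) := fun i => by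
    unfold runsUntilAccept
    classical
    refine .iInf fun k => ?_
    have e : (fun ω => ⨅ _ : X' i k ω ∈ D, ((k : ℝ≥0∞) + 1)) =
        fun ω => (X' i k ⁻¹' D).piecewise (fun _ => (k : ℝ≥0∞) + 1) (fun _ => ⊤) ω := by
      ext ω
      by_cases h : X' i k ω ∈ D <;> simp [Set.piecewise, h]
    rw [e]
    exact .piecewise (hX' i k hD) measurable_const measurable_const
  rw [lintegral_congr_ae hruns, lintegral_finsetSum _ fun i _ => hmeas i]
  calc ∑ i, ∫⁻ ω, runsUntilAccept D (fun k => X' i k ω) ∂μ ≤ ∑ _i : Fin M, (P D)⁻¹ :=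
        Finset.sum_le_sum fun i _ => lintegral_runsUntilAccept_le hD (hX' i) (hlaw' i) (hrow i)
    _ = M * (P D)⁻¹ := by simp

end Rejection

/-! ### The Gaussian kernel on the circle -/

/-- The normalization of the Gaussian kernel. -/
noncomputable def kernelMass (σ : ℝ) : ℝ := ∫ y in (-π)..π, exp (-y ^ 2 / (2 * σ ^ 2))

lemma kernelMass_pos (σ : ℝ) : 0 < kernelMass σ :=
  intervalIntegral.intervalIntegral_pos_of_pos
    (Continuous.intervalIntegrable (by fun_prop) _ _) (fun _ => exp_pos _) (by linarith [pi_pos])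

lemma kernelMass_le {σ : ℝ} (hσ : 0 < σ) : kernelMass σ ≤ 3 * σ := by
  have h := truncatedMass_le hσ (-π) π 0
  rw [kernelMass, intervalIntegral.integral_of_le (by linarith [pi_pos]),
    ← integral_Icc_eq_integral_Ioc]
  simpa [truncatedMass, gaussianWeight] using h

lemma gaussianKernel_nonneg (σ x : ℝ) : 0 ≤ gaussianKernel σ x :=
  div_nonneg (exp_pos _).le (kernelMass_pos σ).le

lemma gaussianKernel_sub_eq (σ : ℝ) {x φ : ℝ} (h : |x - φ| ≤ π) :
    gaussianKernel σ (x - φ) = gaussianWeight σ φ x / kernelMass σ := by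
  have h2 : (toIocMod two_pi_pos (-π) (x - φ)) ^ 2 = (x - φ) ^ 2 := by
    rcases (abs_le.1 h).1.eq_or_lt with h1 | h1
    · have e : toIocMod two_pi_pos (-π) (x - φ) = -π + 2 * π := by
        rw [← h1, toIocMod_apply_left]
      rw [e, ← h1]; ring
    · rw [(toIocMod_eq_self two_pi_pos).2 ⟨h1, by linarith [(abs_le.1 h).2]⟩]
  rw [gaussianKernel, h2]; rfl

lemma gaussianKernel_le {σ x d : ℝ} (hσ : 0 < σ) (hd : 0 ≤ d) (h : ∀ n : ℤ, d ≤ |x - n * (2 * π)|) :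
    gaussianKernel σ x ≤ exp (-d ^ 2 / (2 * σ ^ 2)) / kernelMass σ := by
  have h1 := h (toIocDiv two_pi_pos (-π) x)
  have e : toIocMod two_pi_pos (-π) x = x - toIocDiv two_pi_pos (-π) x * (2 * π) := by
    rw [toIocMod, zsmul_eq_mul]
  rw [← e] at h1
  have h2 : d ^ 2 ≤ (toIocMod two_pi_pos (-π) x) ^ 2 := by
    rw [← sq_abs (toIocMod _ _ _)]; gcongr
  have := kernelMass_pos σ
  rw [gaussianKernel]
  change _ / kernelMass σ ≤ _
  gcongr

lemma measurable_gaussianKernel (σ : ℝ) : Measurable (gaussianKernel σ) := by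
  have h : Measurable (toIocMod two_pi_pos (-π)) := by
    have e : toIocMod two_pi_pos (-π) =
        fun x => x - ((-⌊(-π + 2 * π - x) / (2 * π)⌋ : ℤ) : ℝ) * (2 * π) := by
      ext x
      rw [toIocMod, toIocDiv_eq_neg_floor, zsmul_eq_mul]
    rw [e]
    have h1 : Measurable fun x : ℝ => ⌊(-π + 2 * π - x) / (2 * π)⌋ :=
      Int.measurable_floor.comp (by fun_prop)
    have h2 : Measurable fun x : ℝ => ((-⌊(-π + 2 * π - x) / (2 * π)⌋ : ℤ) : ℝ) :=
      (measurable_from_top (f := fun n : ℤ => ((-n : ℤ) : ℝ))).comp h1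
    fun_prop
  unfold gaussianKernel
  fun_prop

/-! ### The estimator depends on the samples through their mean -/

lemma singlePhaseModel_gaussianKernel {σ a b x φ : ℝ} (hab : b - a ≤ π)
    (hx : x ∈ Icc a b) (hφ : φ ∈ Icc a b) :
    singlePhaseModel (gaussianKernel σ) (Icc a b) x φ =
      gaussianWeight σ φ x / truncatedMass σ a b φ := by
  have hnear : ∀ y ∈ Icc a b, |y - φ| ≤ π := fun y hy =>
    abs_le.2 ⟨by linarith [hy.1, hφ.2], by linarith [hy.2, hφ.1]⟩
  rw [singlePhaseModel, gaussianKernel_sub_eq σ (hnear x hx),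
    setIntegral_congr_fun measurableSet_Icc fun y hy => gaussianKernel_sub_eq σ (hnear y hy),
    integral_div, div_div_div_cancel_right₀ (kernelMass_pos σ).ne', truncatedMass]

lemma truncatedMass_pos {σ a b φ : ℝ} (hσ : 0 < σ) (hab : a < b) (hφ : φ ∈ Icc a b) :
    0 < truncatedMass σ a b φ := by
  have hℓ : 0 < min σ (b - a) / 2 := by have := lt_min hσ (sub_pos.2 hab); linarith
  have := le_truncatedMass hσ hℓ.le (by linarith [min_le_left σ (b - a)])
    (by linarith [min_le_right σ (b - a)]) hφ
  linarith

lemma log_singlePhaseModel_gaussianKernel {σ a b x φ : ℝ} (hσ : 0 < σ) (hlt : a < b)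
    (hab : b - a ≤ π) (hx : x ∈ Icc a b) (hφ : φ ∈ Icc a b) :
    log (singlePhaseModel (gaussianKernel σ) (Icc a b) x φ) =
      -x ^ 2 / (2 * σ ^ 2) + (x * (φ / σ ^ 2) - cgf id (truncatedGaussian σ a b) (φ / σ ^ 2)) := by
  have hm := truncatedMass_pos hσ hlt hφ
  rw [singlePhaseModel_gaussianKernel hab hx hφ, log_div (gaussianWeight_pos _ _ _).ne' hm.ne', cgf,
    mgf_truncatedGaussian hσ, log_mul (exp_pos _).ne' hm.ne', log_exp, gaussianWeight, log_exp]
  field_simp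
  ring

lemma logLikelihood_gaussianKernel {σ a b φ : ℝ} (hσ : 0 < σ) (hlt : a < b)
    (hab : b - a ≤ π) {M : ℕ} (hM : 1 ≤ M) {x : Fin M → ℝ} (hx : ∀ i, x i ∈ Icc a b)
    (hφ : φ ∈ Icc a b) :
    logLikelihood (singlePhaseModel (gaussianKernel σ) (Icc a b)) x φ =
      1 / M * ∑ i, -x i ^ 2 / (2 * σ ^ 2) + meanLogLikelihood σ a b (1 / M * ∑ i, x i) φ := by
  have hM0 : (M : ℝ) ≠ 0 := by positivity
  rw [logLikelihood, Finset.sum_congr rfl fun i _ =>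
    log_singlePhaseModel_gaussianKernel hσ hlt hab (hx i) hφ, Finset.sum_add_distrib,
    Finset.sum_sub_distrib, meanLogLikelihood, ← Finset.sum_mul]
  simp
  field_simp

lemma isFMPE_gaussianKernel_iff {σ a b φ : ℝ} (hσ : 0 < σ) (hlt : a < b)
    (hab : b - a ≤ π) {M : ℕ} (hM : 1 ≤ M) {x : Fin M → ℝ} (hx : ∀ i, x i ∈ Icc a b) :
    IsFMPE (gaussianKernel σ) (Icc a b) x φ ↔
      φ ∈ Icc a b ∧ IsMaxOn (meanLogLikelihood σ a b (1 / M * ∑ i, x i)) (Icc a b) φ := by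
  refine and_congr_right fun hφ => forall₂_congr fun φ' hφ' => ?_
  simp only [mem_ofPred_eq]
  rw [logLikelihood_gaussianKernel hσ hlt hab hM hx hφ,
    logLikelihood_gaussianKernel hσ hlt hab hM hx hφ', add_le_add_iff_left]

/-! ### Contaminated truncated Gaussians -/

section Contamination

variable {P : Measure ℝ} {p : ℝ → ℝ} {σ a b A R φ₀ : ℝ}

lemma integrableOn_mul_of_le_add (hpm : Measurable p)
    (hlo : ∀ x ∈ Icc a b, A * gaussianWeight σ φ₀ x ≤ p x)
    (hhi : ∀ x ∈ Icc a b, p x ≤ A * gaussianWeight σ φ₀ x + R) {h : ℝ → ℝ} (hh : Continuous h) :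
    IntegrableOn (fun y => h y * p y) (Icc a b) := by
  have hw : Continuous fun y => |A * gaussianWeight σ φ₀ y| + |R| := by
    have := continuous_gaussianWeight σ φ₀; fun_prop
  have hp : IntegrableOn p (Icc a b) := by
    refine Integrable.mono' hw.continuousOn.integrableOn_Icc hpm.aestronglyMeasurable ?_
    filter_upwards [ae_restrict_mem measurableSet_Icc] with x hx
    rw [norm_eq_abs, abs_le]
    constructor
    · linarith [hlo x hx, neg_abs_le (A * gaussianWeight σ φ₀ x), abs_nonneg R]
    · linarith [hhi x hx, le_abs_self (A * gaussianWeight σ φ₀ x), le_abs_self R]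
  obtain ⟨K, hK⟩ := isCompact_Icc.exists_bound_of_continuousOn (s := Icc a b) hh.continuousOn
  exact hp.bdd_mul hh.aestronglyMeasurable
    ((ae_restrict_mem measurableSet_Icc).mono fun x hx => hK x hx)

lemma integral_cond_eq (hpm : Measurable p) (hp0 : ∀ x ∈ Icc a b, 0 ≤ p x)
    (hP : P.restrict (Icc a b) =
      (volume.restrict (Icc a b)).withDensity fun x => ENNReal.ofReal (p x)) (h : ℝ → ℝ) :
    ∫ y, h y ∂P[|Icc a b] = (P.real (Icc a b))⁻¹ * ∫ y in Icc a b, h y * p y := by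
  rw [ProbabilityTheory.cond, integral_smul_measure, hP, integral_withDensity_eq_integral_toReal_smul
    (by fun_prop) (by simp), ENNReal.toReal_inv, smul_eq_mul]
  congr 1
  refine setIntegral_congr_fun measurableSet_Icc fun y hy => ?_
  simp [ENNReal.toReal_ofReal (hp0 y hy), mul_comm]

lemma measureReal_Icc_eq [IsFiniteMeasure P] (hpm : Measurable p) (hp0 : ∀ x ∈ Icc a b, 0 ≤ p x)
    (hP : P.restrict (Icc a b) =
      (volume.restrict (Icc a b)).withDensity fun x => ENNReal.ofReal (p x)) :
    P.real (Icc a b) = ∫ y in Icc a b, p y := by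
  have h : ∫ _ in Icc a b, (1 : ℝ) ∂P = P.real (Icc a b) := by simp
  rw [← h, hP, integral_withDensity_eq_integral_toReal_smul (by fun_prop) (by simp)]
  refine setIntegral_congr_fun measurableSet_Icc fun y hy => ?_
  simp [ENNReal.toReal_ofReal (hp0 y hy)]

lemma mul_truncatedMass_le_measureReal [IsFiniteMeasure P] (hA : 0 ≤ A) (hpm : Measurable p)
    (hlo : ∀ x ∈ Icc a b, A * gaussianWeight σ φ₀ x ≤ p x)
    (hhi : ∀ x ∈ Icc a b, p x ≤ A * gaussianWeight σ φ₀ x + R)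
    (hP : P.restrict (Icc a b) =
      (volume.restrict (Icc a b)).withDensity fun x => ENNReal.ofReal (p x)) :
    A * truncatedMass σ a b φ₀ ≤ P.real (Icc a b) := by
  have hp0 : ∀ x ∈ Icc a b, 0 ≤ p x := fun x hx =>
    (mul_nonneg hA (gaussianWeight_pos _ _ _).le).trans (hlo x hx)
  rw [measureReal_Icc_eq hpm hp0 hP, truncatedMass, ← integral_const_mul]
  refine setIntegral_mono_on ((integrableOn_gaussianWeight _ _ _ _).const_mul _) ?_
    measurableSet_Icc hlo
  simpa using integrableOn_mul_of_le_add hpm hlo hhi (h := fun _ => 1) continuous_const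

lemma truncatedMean_mem_Icc (hσ : 0 < σ) (hab : a < b) (hφ₀ : φ₀ ∈ Icc a b) :
    truncatedMean σ a b φ₀ ∈ Icc a b := by
  have hm := truncatedMass_pos hσ hab hφ₀
  have hi := integrableOn_mul_gaussianWeight (h := fun y => y) continuous_id σ φ₀ a b
  rw [truncatedMean]
  constructor
  · rw [le_div_iff₀ hm, truncatedMass, ← integral_const_mul]
    exact setIntegral_mono_on ((integrableOn_gaussianWeight _ _ _ _).const_mul _) hi
      measurableSet_Icc fun y hy => mul_le_mul_of_nonneg_right hy.1 (gaussianWeight_pos _ _ _).le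
  · rw [div_le_iff₀ hm, truncatedMass, ← integral_const_mul]
    exact setIntegral_mono_on hi ((integrableOn_gaussianWeight _ _ _ _).const_mul _)
      measurableSet_Icc fun y hy => mul_le_mul_of_nonneg_right hy.2 (gaussianWeight_pos _ _ _).le

/-- The bias of the sample mean caused by a contamination of density at most `R`. -/
lemma abs_integral_cond_sub_truncatedMean_le [IsProbabilityMeasure P] (hσ : 0 < σ) (hab : a < b)
    (hφ₀ : φ₀ ∈ Icc a b) (hA : 0 < A) (hR : 0 ≤ R) (hpm : Measurable p)
    (hlo : ∀ x ∈ Icc a b, A * gaussianWeight σ φ₀ x ≤ p x)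
    (hhi : ∀ x ∈ Icc a b, p x ≤ A * gaussianWeight σ φ₀ x + R)
    (hP : P.restrict (Icc a b) =
      (volume.restrict (Icc a b)).withDensity fun x => ENNReal.ofReal (p x)) :
    |∫ y, y ∂P[|Icc a b] - truncatedMean σ a b φ₀| ≤
      (b - a) ^ 2 * R / (A * truncatedMass σ a b φ₀) := by
  have hp0 : ∀ x ∈ Icc a b, 0 ≤ p x := fun x hx =>
    (mul_nonneg hA.le (gaussianWeight_pos _ _ _).le).trans (hlo x hx)
  have hm := truncatedMass_pos hσ hab hφ₀
  have hmass := mul_truncatedMass_le_measureReal hA.le hpm hlo hhi hP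
  have hpos : 0 < P.real (Icc a b) := (mul_pos hA hm).trans_le hmass
  set m := truncatedMean σ a b φ₀ with hmdef
  have hmm : m ∈ Icc a b := truncatedMean_mem_Icc hσ hab hφ₀
  have hi1 := integrableOn_mul_of_le_add hpm hlo hhi (h := fun y => y) continuous_id
  have hi2 : IntegrableOn p (Icc a b) := by
    simpa using integrableOn_mul_of_le_add hpm hlo hhi (h := fun _ => 1) continuous_const
  have hw1 := integrableOn_mul_gaussianWeight (h := fun y => y) continuous_id σ φ₀ a b
  have hw2 := integrableOn_gaussianWeight σ φ₀ a b
  have hzero : ∫ y in Icc a b, (y - m) * gaussianWeight σ φ₀ y = 0 := by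
    simp_rw [sub_mul]
    rw [integral_sub hw1 (hw2.const_mul _), integral_const_mul, ← truncatedMass, hmdef,
      truncatedMean, div_mul_cancel₀ _ hm.ne', sub_self]
  have hi3 : IntegrableOn (fun y => (y - m) * p y) (Icc a b) :=
    integrableOn_mul_of_le_add hpm hlo hhi (by fun_prop)
  have hw3 : IntegrableOn (fun y => (y - m) * gaussianWeight σ φ₀ y) (Icc a b) :=
    integrableOn_mul_gaussianWeight (by fun_prop) _ _ _ _
  have key : ∫ y, y ∂P[|Icc a b] - m = (P.real (Icc a b))⁻¹ *
      ∫ y in Icc a b, (y - m) * (p y - A * gaussianWeight σ φ₀ y) := by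
    have e : ∫ y in Icc a b, (y - m) * (p y - A * gaussianWeight σ φ₀ y) =
        (∫ y in Icc a b, y * p y) - m * P.real (Icc a b) := by
      rw [measureReal_Icc_eq hpm hp0 hP, ← integral_const_mul,
        ← integral_sub hi1 (hi2.const_mul m)]
      have e2 : ∀ y, (y - m) * (p y - A * gaussianWeight σ φ₀ y) =
          (y - m) * p y - A * ((y - m) * gaussianWeight σ φ₀ y) := fun y => by ring
      simp_rw [e2]
      rw [integral_sub hi3 (hw3.const_mul A), integral_const_mul, hzero, mul_zero, sub_zero]
      simp_rw [sub_mul]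
    rw [e, integral_cond_eq hpm hp0 hP]
    field_simp
  have hbound : |∫ y in Icc a b, (y - m) * (p y - A * gaussianWeight σ φ₀ y)| ≤
      (b - a) ^ 2 * R := by
    have := norm_setIntegral_le_of_norm_le_const (μ := volume) (s := Icc a b)
      (f := fun y => (y - m) * (p y - A * gaussianWeight σ φ₀ y)) (C := (b - a) * R)
      (by simp) (fun y hy => by
        rw [norm_mul, norm_eq_abs, norm_eq_abs]
        refine mul_le_mul (abs_le.2 ⟨by linarith [hy.1, hmm.2], by linarith [hy.2, hmm.1]⟩)
          (abs_le.2 ⟨by linarith [hlo y hy], by linarith [hhi y hy]⟩) (abs_nonneg _)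
          (by linarith))
    rw [norm_eq_abs, volume_real_Icc_of_le hab.le] at this
    linarith
  rw [key, abs_mul, abs_of_pos (inv_pos.2 hpos), inv_mul_eq_div]
  have := mul_pos hA hm
  gcongr

/-- The variance of a contaminated truncated Gaussian. -/
lemma variance_cond_le [IsProbabilityMeasure P] (hσ : 0 < σ) (hab : a < b)
    (hφ₀ : φ₀ ∈ Icc a b) (hA : 0 < A) (hR : 0 ≤ R) (hpm : Measurable p)
    (hlo : ∀ x ∈ Icc a b, A * gaussianWeight σ φ₀ x ≤ p x)
    (hhi : ∀ x ∈ Icc a b, p x ≤ A * gaussianWeight σ φ₀ x + R)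
    (hP : P.restrict (Icc a b) =
      (volume.restrict (Icc a b)).withDensity fun x => ENNReal.ofReal (p x)) :
    Var[id; P[|Icc a b]] ≤
      (A * (16 * σ ^ 3) + (b - a) ^ 3 * R) / (A * truncatedMass σ a b φ₀) := by
  have hp0 : ∀ x ∈ Icc a b, 0 ≤ p x := fun x hx =>
    (mul_nonneg hA.le (gaussianWeight_pos _ _ _).le).trans (hlo x hx)
  have hm := truncatedMass_pos hσ hab hφ₀
  have hmass := mul_truncatedMass_le_measureReal hA.le hpm hlo hhi hP
  have hpos : 0 < P.real (Icc a b) := (mul_pos hA hm).trans_le hmass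
  have hne : P (Icc a b) ≠ 0 := fun h => by simp [Measure.real, h] at hpos
  have := cond_isProbabilityMeasure (μ := P) (s := Icc a b) hne
  have h1 : Var[id; P[|Icc a b]] ≤ ∫ y, (y - φ₀) ^ 2 ∂P[|Icc a b] := by
    rw [← variance_sub_const (X := id) aestronglyMeasurable_id φ₀]
    exact variance_le_expectation_sq (by fun_prop)
  refine h1.trans ?_
  have hw : IntegrableOn (fun y => (y - φ₀) ^ 2 * gaussianWeight σ φ₀ y) (Icc a b) :=
    integrableOn_mul_gaussianWeight (by fun_prop) _ _ _ _
  have hc : IntegrableOn (fun _ : ℝ => (b - a) ^ 2 * R) (Icc a b) :=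
    continuous_const.continuousOn.integrableOn_Icc
  have hnum : ∫ y in Icc a b, (y - φ₀) ^ 2 * p y ≤ A * (16 * σ ^ 3) + (b - a) ^ 3 * R := by
    calc ∫ y in Icc a b, (y - φ₀) ^ 2 * p y
        ≤ ∫ y in Icc a b, (A * ((y - φ₀) ^ 2 * gaussianWeight σ φ₀ y) + (b - a) ^ 2 * R) := by
          refine setIntegral_mono_on (integrableOn_mul_of_le_add hpm hlo hhi (by fun_prop))
            ((hw.const_mul A).add hc) measurableSet_Icc fun y hy => ?_
          have hy2 : (y - φ₀) ^ 2 ≤ (b - a) ^ 2 :=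
            sq_le_sq' (by linarith [hy.1, hφ₀.2]) (by linarith [hy.2, hφ₀.1])
          have h2 := mul_le_mul_of_nonneg_left (hhi y hy) (sq_nonneg (y - φ₀))
          have h3 := mul_le_mul_of_nonneg_right hy2 hR
          linarith
      _ = A * (∫ y in Icc a b, (y - φ₀) ^ 2 * gaussianWeight σ φ₀ y) + (b - a) ^ 3 * R := by
          rw [integral_add (hw.const_mul A) hc, integral_const_mul, setIntegral_const,
            volume_real_Icc_of_le hab.le, smul_eq_mul]
          ring
      _ ≤ _ := by
          gcongr
          exact integral_sq_mul_gaussianWeight_le hσ a b φ₀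
  rw [integral_cond_eq hpm hp0 hP, inv_mul_eq_div]
  have := mul_pos hA hm
  have hba := sub_pos.2 hab
  gcongr

end Contamination

/-! ### The outcome law near the target phase -/

section OutcomeLaw

variable {H : Type*} [NormedAddCommGroup H] [InnerProductSpace ℂ H] {U : H ≃ₗᵢ[ℂ] H}
  {ι : Type*} [Fintype ι] (E : EigenDecomposition U ι) {ψ : H}

lemma EigenDecomposition.weight_nonneg (ψ : H) (j : ι) : 0 ≤ E.weight ψ j := sq_nonneg _

lemma EigenDecomposition.sum_weight (hψ : ‖ψ‖ = 1) : ∑ j, E.weight ψ j = 1 := by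
  simp only [weight]
  rw [E.basis.sum_sq_norm_inner_right, hψ, one_pow]

lemma EigenDecomposition.weight_le_one (hψ : ‖ψ‖ = 1) (j : ι) : E.weight ψ j ≤ 1 := by
  rw [← E.sum_weight hψ]
  exact Finset.single_le_sum (f := E.weight ψ) (fun i _ => E.weight_nonneg ψ i) (Finset.mem_univ j)

/-- The density of the outcome law. -/
noncomputable def EigenDecomposition.density (ψ : H) (σ x : ℝ) : ℝ :=
  ∑ j, E.weight ψ j * gaussianKernel σ (x - E.phase j)

lemma EigenDecomposition.measurable_density (ψ : H) (σ : ℝ) : Measurable (E.density ψ σ) := by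
  unfold density
  exact Finset.measurable_fun_sum _ fun j _ =>
    ((measurable_gaussianKernel σ).comp (measurable_id.sub_const _)).const_mul _

lemma EigenDecomposition.outcomeLaw_restrict (ψ : H) (σ : ℝ) {a b : ℝ}
    (hD : Icc a b ⊆ Ico 0 (2 * π)) :
    (E.outcomeLaw ψ (gaussianKernel σ)).restrict (Icc a b) =
      (volume.restrict (Icc a b)).withDensity fun x => ENNReal.ofReal (E.density ψ σ x) := by
  rw [outcomeLaw, restrict_withDensity measurableSet_Icc,
    Measure.restrict_restrict measurableSet_Icc, inter_eq_left.2 hD]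
  rfl

lemma EigenDecomposition.le_density {σ x : ℝ} {j₀ : ι} (hx : |x - E.phase j₀| ≤ π) :
    E.weight ψ j₀ / kernelMass σ * gaussianWeight σ (E.phase j₀) x ≤ E.density ψ σ x := by
  rw [div_mul_eq_mul_div, mul_div_assoc, ← gaussianKernel_sub_eq σ hx]
  exact Finset.single_le_sum (f := fun j => E.weight ψ j * gaussianKernel σ (x - E.phase j))
    (fun j _ => mul_nonneg (E.weight_nonneg ψ j) (gaussianKernel_nonneg _ _)) (Finset.mem_univ j₀)

/-- Phases at distance `d` on the circle contribute at most the tail of the kernel at `d`. -/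
lemma EigenDecomposition.density_le {σ x d : ℝ} {j₀ : ι} (hσ : 0 < σ) (hψ : ‖ψ‖ = 1) (hd : 0 ≤ d)
    (hx : |x - E.phase j₀| ≤ π)
    (hfar : ∀ j, j ≠ j₀ → ∀ n : ℤ, d ≤ |x - E.phase j - n * (2 * π)|) :
    E.density ψ σ x ≤ E.weight ψ j₀ / kernelMass σ * gaussianWeight σ (E.phase j₀) x +
      exp (-d ^ 2 / (2 * σ ^ 2)) / kernelMass σ := by
  classical
  set R := exp (-d ^ 2 / (2 * σ ^ 2)) / kernelMass σ with hRdef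
  have hR : 0 ≤ R := div_nonneg (exp_pos _).le (kernelMass_pos σ).le
  rw [density, ← Finset.add_sum_erase _ _ (Finset.mem_univ j₀), div_mul_eq_mul_div, mul_div_assoc,
    ← gaussianKernel_sub_eq σ hx]
  gcongr
  calc ∑ j ∈ Finset.univ.erase j₀, E.weight ψ j * gaussianKernel σ (x - E.phase j)
      ≤ ∑ j ∈ Finset.univ.erase j₀, E.weight ψ j * R :=
        Finset.sum_le_sum fun j hj => mul_le_mul_of_nonneg_left
          (gaussianKernel_le hσ hd (hfar j (Finset.ne_of_mem_erase hj))) (E.weight_nonneg ψ j)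
    _ ≤ ∑ j, E.weight ψ j * R :=
        Finset.sum_le_sum_of_subset_of_nonneg (Finset.erase_subset _ _)
          fun j _ _ => mul_nonneg (E.weight_nonneg ψ j) hR
    _ = R := by rw [← Finset.sum_mul, E.sum_weight hψ, one_mul]

/-- Eigenphases other than the target are far, on the circle, from the filter interval. -/
lemma le_abs_sub_sub_int_mul_two_pi {Δ φ φ₀ g x : ℝ} (hφ : φ ∈ Ico 0 (2 * π))
    (hgap : Δ < |φ - φ₀|) (hg : |φ₀ - g| < Δ / 3) (hx : x ∈ filterInterval g Δ)
    (hD : filterInterval g Δ ⊆ Ico (Δ / 6) (2 * π - Δ / 6)) (n : ℤ) :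
    Δ / 6 ≤ |x - φ - n * (2 * π)| := by
  obtain ⟨hx1, hx2⟩ := hx
  obtain ⟨hd1, hd2⟩ := hD ⟨hx1, hx2⟩
  obtain ⟨hg1, hg2⟩ := abs_lt.1 hg
  have hpi := pi_pos
  rcases lt_trichotomy n 0 with hn | rfl | hn
  · have : (n : ℝ) ≤ -1 := by exact_mod_cast Int.le_sub_one_of_lt hn
    refine le_trans ?_ (le_abs_self _)
    nlinarith [hφ.2]
  · simp only [Int.cast_zero, zero_mul, sub_zero]
    rcases lt_abs.1 hgap with h | h
    · refine le_trans ?_ (neg_le_abs _); linarith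
    · refine le_trans ?_ (le_abs_self _); linarith
  · have : (1 : ℝ) ≤ n := by exact_mod_cast hn
    refine le_trans ?_ (neg_le_abs _)
    nlinarith [hφ.1]

end OutcomeLaw

/-! ### The error of the estimator -/

section Error

variable {Ω : Type*} [MeasurableSpace Ω] {μ : Measure Ω} {P : Measure ℝ}

lemma integrable_sq_fmpe_sub [IsProbabilityMeasure μ] {σ a b φ₀ : ℝ} (hσ : 0 < σ) (hlt : a < b)
    (hab : b - a ≤ π) {M : ℕ} (hM : 1 ≤ M) (hP : ∀ᵐ y ∂P, y ∈ Icc a b) {Y : Fin M → Ω → ℝ}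
    (hlaw : ∀ i, HasLaw (Y i) P μ) {est : (Fin M → ℝ) → ℝ}
    (hest : ∀ x : Fin M → ℝ, (∀ i, x i ∈ Icc a b) →
      IsFMPE (gaussianKernel σ) (Icc a b) x (est x)) :
    Integrable (fun ω => (est (fun i => Y i ω) - φ₀) ^ 2) μ ∧
    ∀ᵐ ω ∂μ, est (fun i => Y i ω) ∈ Icc a b ∧
      IsMaxOn (meanLogLikelihood σ a b (1 / M * ∑ i, Y i ω)) (Icc a b) (est (fun i => Y i ω)) := by
  have hY : ∀ᵐ ω ∂μ, ∀ i, Y i ω ∈ Icc a b := ae_all_iff.2 fun i =>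
    ((hlaw i).ae_iff (p := fun y => y ∈ Icc a b) measurableSet_Icc.mem).2 hP
  have hspec : ∀ᵐ ω ∂μ, est (fun i => Y i ω) ∈ Icc a b ∧
      IsMaxOn (meanLogLikelihood σ a b (1 / M * ∑ i, Y i ω)) (Icc a b)
        (est (fun i => Y i ω)) := by
    filter_upwards [hY] with ω hω
    exact (isFMPE_gaussianKernel_iff hσ hlt hab hM hω).1 (hest _ hω)
  refine ⟨?_, hspec⟩
  have hmean : AEMeasurable (fun ω => 1 / (M : ℝ) * ∑ i, Y i ω) μ :=
    (Finset.aemeasurable_fun_sum _ fun i _ => (hlaw i).aemeasurable).const_mul _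
  have hmeas : AEStronglyMeasurable
      (fun ω => (meanEstimator σ a b (1 / M * ∑ i, Y i ω) - φ₀) ^ 2) μ :=
    ((((monotone_meanEstimator hσ hlt).measurable.comp_aemeasurable hmean).sub_const φ₀).pow_const
      2).aestronglyMeasurable
  have heq : (fun ω => (meanEstimator σ a b (1 / M * ∑ i, Y i ω) - φ₀) ^ 2) =ᵐ[μ]
      fun ω => (est (fun i => Y i ω) - φ₀) ^ 2 := by
    filter_upwards [hspec] with ω hω
    rw [(existsUnique_isMaxOn_meanLogLikelihood hσ hlt _).unique
      (meanEstimator_spec hσ hlt _) hω]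
  refine Integrable.of_bound (hmeas.congr heq) ((|a - φ₀| + |b - φ₀|) ^ 2) ?_
  filter_upwards [hspec] with ω hω
  rw [norm_pow, norm_eq_abs]
  have := abs_le_max_abs_abs (sub_le_sub_right hω.1.1 φ₀) (sub_le_sub_right hω.1.2 φ₀)
  gcongr
  exact this.trans (max_le_add_of_nonneg (abs_nonneg _) (abs_nonneg _))

/-- The mean square error is controlled by the variance of the samples and the bias of their
mean. -/
lemma integral_sq_fmpe_sub_le [IsProbabilityMeasure μ] {σ a b c φ₀ : ℝ} (hσ : 0 < σ) (hlt : a < b)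
    (hab : b - a ≤ π) (hφ₀ : φ₀ ∈ Icc a b) (hc0 : 0 < c)
    (hc : ∀ φ ∈ Icc a b, c ≤ truncatedVariance σ a b φ / σ ^ 2)
    {M : ℕ} (hM : 1 ≤ M) (hP : ∀ᵐ y ∂P, y ∈ Icc a b) {Y : Fin M → Ω → ℝ}
    (hlaw : ∀ i, HasLaw (Y i) P μ) (hind : Pairwise fun i j => IndepFun (Y i) (Y j) μ)
    {est : (Fin M → ℝ) → ℝ}
    (hest : ∀ x : Fin M → ℝ, (∀ i, x i ∈ Icc a b) →
      IsFMPE (gaussianKernel σ) (Icc a b) x (est x)) :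
    c ^ 2 * ∫ ω, (est (fun i => Y i ω) - φ₀) ^ 2 ∂μ ≤
      Var[id; P] / M + (∫ y, y ∂P - truncatedMean σ a b φ₀) ^ 2 := by
  obtain ⟨hinteg, hspec⟩ := integrable_sq_fmpe_sub (φ₀ := φ₀) hσ hlt hab hM hP hlaw hest
  obtain ⟨hinteg', heq⟩ := integral_sq_empiricalMean_sub hM hP hlaw hind (truncatedMean σ a b φ₀)
  rw [← heq, ← integral_const_mul]
  refine integral_mono_ae (hinteg.const_mul _) hinteg' ?_
  filter_upwards [hspec] with ω hω
  have h := IsMaxOn.mul_abs_sub_le hσ hc hω.1 hω.2 hφ₀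
  have h2 := pow_le_pow_left₀ (by positivity) h 2
  rwa [mul_pow, sq_abs, sq_abs] at h2

end Error

/-! ### Numerical bounds -/

lemma contamination_le {σ Δ ε η : ℝ} (hσ : 0 < σ) (hη : 0 < η) (hε : 0 < ε) (hεΔ : ε ≤ Δ)
    (hu : 720000 * σ ≤ Δ) (hexp : Δ ≤ ε * η * exp (Δ ^ 2 / (144 * σ ^ 2))) :
    Δ ^ 2 * exp (-(Δ / 6) ^ 2 / (2 * σ ^ 2)) / (η * σ) ≤ ε / 5000 ∧
      Δ ^ 3 * exp (-(Δ / 6) ^ 2 / (2 * σ ^ 2)) / (η * σ) ≤ σ ^ 2 := by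
  have hΔ : 0 < Δ := hε.trans_le hεΔ
  set v := Δ ^ 2 / (144 * σ ^ 2) with hv
  have hv0 : 0 ≤ v := by positivity
  set T := exp (-v) with hT
  have hT0 : 0 < T := exp_pos _
  have hTT : exp v * T = 1 := by rw [hT, ← exp_add]; simp
  have hδ : exp (-(Δ / 6) ^ 2 / (2 * σ ^ 2)) = T * T := by
    rw [hT, ← exp_add, hv]; congr 1; field_simp; ring
  have h1 : Δ * T ≤ ε * η := by
    calc Δ * T ≤ ε * η * exp v * T := by gcongr
      _ = ε * η := by rw [mul_assoc, hTT, mul_one]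
  have h2 : v * T ≤ 1 := by
    rw [← hTT]; gcongr; linarith [add_one_le_exp v]
  have h3 : v ^ 2 / 2 * T ≤ 1 := by
    rw [← hTT]; gcongr; linarith [quadratic_le_exp_of_nonneg hv0]
  have h2' : Δ ^ 2 * T ≤ 144 * σ ^ 2 := by
    have e : Δ ^ 2 = v * (144 * σ ^ 2) := by rw [hv]; field_simp
    rw [e]; nlinarith [sq_pos_of_pos hσ]
  have h3' : Δ ^ 4 * T ≤ 41472 * σ ^ 4 := by
    have e : Δ ^ 4 = v ^ 2 / 2 * (41472 * σ ^ 4) := by rw [hv]; field_simp; norm_num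
    rw [e]; nlinarith [pow_pos hσ 4]
  have h4 : 5000 * (Δ * T) ≤ σ := by
    refine le_of_mul_le_mul_right ?_ hΔ
    nlinarith
  have h5 : Δ ^ 3 * T ≤ σ ^ 3 := by
    refine le_of_mul_le_mul_right ?_ hΔ
    nlinarith [pow_pos hσ 3]
  rw [hδ]
  constructor
  · rw [div_le_iff₀ (by positivity)]
    calc Δ ^ 2 * (T * T) = (Δ * T) * (Δ * T) := by ring
      _ ≤ (ε * η) * (σ / 5000) := by gcongr; linarith
      _ = _ := by ring
  · rw [div_le_iff₀ (by positivity)]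
    calc Δ ^ 3 * (T * T) = (Δ * T) * (Δ ^ 2 * T) := by ring
      _ ≤ (ε * η) * (Δ ^ 2 * T) := by gcongr
      _ ≤ (Δ * η) * (Δ ^ 2 * T) := by gcongr
      _ = η * (Δ ^ 3 * T) := by ring
      _ ≤ η * σ ^ 3 := by gcongr
      _ = _ := by ring

lemma le_mul_exp_of_sqrt_log_le {κ Δ η ε σ t : ℝ} (hκ : 0 < κ) (hΔ : 0 < Δ) (hη : 0 < η)
    (hε : 0 < ε) (hσ : 0 < σ) (htσ : t * σ ≤ κ)
    (ht : 2160000 * κ * Δ⁻¹ * sqrt (log (Δ * ε⁻¹ * η⁻¹)) ≤ t) :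
    Δ ≤ ε * η * exp ((Δ / (2160000 * σ)) ^ 2) := by
  have h1 : sqrt (log (Δ * ε⁻¹ * η⁻¹)) ≤ Δ / (2160000 * σ) := by
    rw [le_div_iff₀ (by positivity)]
    have h2 : 2160000 * κ * Δ⁻¹ * sqrt (log (Δ * ε⁻¹ * η⁻¹)) * σ ≤ κ :=
      (mul_le_mul_of_nonneg_right ht hσ.le).trans htσ
    have h3 : 2160000 * κ * Δ⁻¹ * sqrt (log (Δ * ε⁻¹ * η⁻¹)) * σ =
        κ * (sqrt (log (Δ * ε⁻¹ * η⁻¹)) * (2160000 * σ) / Δ) := by field_simp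
    rw [h3] at h2
    have h4 := le_of_mul_le_mul_left (h2.trans_eq (mul_one κ).symm) hκ
    rwa [div_le_one hΔ] at h4
  have h2 := (sqrt_le_iff.1 h1).2
  rw [log_le_iff_le_exp (by positivity)] at h2
  calc Δ = ε * η * (Δ * ε⁻¹ * η⁻¹) := by field_simp
    _ ≤ _ := by gcongr

lemma div_add_one_le_div_sq {κ B K L ε σ t : ℝ} (hK : 0 ≤ K) (hL : 0 ≤ L) (hε : 0 < ε) (hσ : 0 < σ)
    (ht : 0 < t) (htσ : t * σ ≤ κ) (htε : t * ε ≤ B) :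
    K * σ ^ 2 / ε ^ 2 + L ≤ (K * κ ^ 2 + L * B ^ 2) * (t ^ 2)⁻¹ * (ε ^ 2)⁻¹ := by
  have h1 : (t * σ) ^ 2 ≤ κ ^ 2 := pow_le_pow_left₀ (by positivity) htσ 2
  have h2 : (t * ε) ^ 2 ≤ B ^ 2 := pow_le_pow_left₀ (by positivity) htε 2
  calc K * σ ^ 2 / ε ^ 2 + L
      = (K * (t * σ) ^ 2 + L * (t * ε) ^ 2) * (t ^ 2)⁻¹ * (ε ^ 2)⁻¹ := by field_simp
    _ ≤ _ := by gcongr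

lemma cost_le_of_narrow {κ B η ε σ t m M : ℝ} (hη : 0 < η) (hε : 0 < ε) (hσ : 0 < σ)
    (ht : 0 < t) (htσ : t * σ ≤ κ) (htε : t * ε ≤ B) (hm : 7 / 16 * σ ≤ m)
    (hM : M ≤ 60000000 * σ ^ 2 / ε ^ 2 + 2) :
    M * (3 * σ / (η * m)) ≤
      7 * (60000000 * κ ^ 2 + 2 * B ^ 2) * η⁻¹ * (t ^ 2)⁻¹ * (ε ^ 2)⁻¹ := by
  have hm0 : 0 < m := by linarith
  have h1 : 3 * σ / (η * m) ≤ 7 * η⁻¹ := by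
    rw [div_le_iff₀ (by positivity)]
    have : 7 * η⁻¹ * (η * m) = 7 * m := by field_simp
    linarith
  calc M * (3 * σ / (η * m)) ≤ (60000000 * σ ^ 2 / ε ^ 2 + 2) * (7 * η⁻¹) := by gcongr
    _ ≤ ((60000000 * κ ^ 2 + 2 * B ^ 2) * (t ^ 2)⁻¹ * (ε ^ 2)⁻¹) * (7 * η⁻¹) := by
        gcongr
        exact div_add_one_le_div_sq (by norm_num) (by norm_num) hε hσ ht htσ htε
    _ = _ := by ring

lemma cost_le_of_wide {κ B η ε σ Δ t m : ℝ} (hη : 0 < η) (hε : 0 < ε) (hεΔ : ε ≤ Δ) (hσ : 0 < σ)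
    (ht : 0 < t) (htσ : t * σ ≤ κ) (htε : t * ε ≤ B) (hm : 7 / 16 * min σ Δ ≤ m) :
    3 * σ / (η * m) ≤
      7 * (60000000 * κ ^ 2 + 2 * B ^ 2) * η⁻¹ * (t ^ 2)⁻¹ * (ε ^ 2)⁻¹ := by
  have hΔ : 0 < Δ := hε.trans_le hεΔ
  have hm0 : 0 < m := lt_of_lt_of_le (by have := lt_min hσ hΔ; positivity) hm
  have h1 : 3 * σ / m ≤ 7 * (1 * σ ^ 2 / ε ^ 2 + 1) := by
    rw [div_le_iff₀ hm0]
    have h0 : 0 ≤ σ ^ 2 / ε ^ 2 := by positivity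
    rcases le_total σ Δ with h | h
    · rw [min_eq_left h] at hm
      have h3 : 0 ≤ σ ^ 2 / ε ^ 2 * m := by positivity
      rw [one_mul]
      linarith
    · rw [min_eq_right h] at hm
      have h2 : σ ≤ σ ^ 2 / ε ^ 2 * Δ := by
        rw [div_mul_eq_mul_div, le_div_iff₀ (by positivity)]
        calc σ * ε ^ 2 ≤ σ * (ε * Δ) := by rw [sq]; gcongr
          _ ≤ σ * (σ * Δ) := by gcongr; linarith
          _ = _ := by ring
      have h3 : σ ^ 2 / ε ^ 2 * (7 / 16 * Δ) ≤ σ ^ 2 / ε ^ 2 * m := by gcongr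
      rw [one_mul]
      linarith
  calc 3 * σ / (η * m) = 3 * σ / m * η⁻¹ := by field_simp
    _ ≤ 7 * (1 * σ ^ 2 / ε ^ 2 + 1) * η⁻¹ := by gcongr
    _ ≤ 7 * ((1 * κ ^ 2 + 1 * B ^ 2) * (t ^ 2)⁻¹ * (ε ^ 2)⁻¹) * η⁻¹ := by
        gcongr
        exact div_add_one_le_div_sq (by norm_num) (by norm_num) hε hσ ht htσ htε
    _ ≤ 7 * ((60000000 * κ ^ 2 + 2 * B ^ 2) * (t ^ 2)⁻¹ * (ε ^ 2)⁻¹) * η⁻¹ := by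
        gcongr <;> norm_num
    _ = _ := by ring

lemma contaminated_moments_le {σ Δ ε η w Z m : ℝ} (hσ : 0 < σ) (hη : 0 < η) (hε : 0 < ε)
    (hεΔ : ε ≤ Δ) (hu : 720000 * σ ≤ Δ) (hexp : Δ ≤ ε * η * exp ((Δ / (2160000 * σ)) ^ 2))
    (hw : η ≤ w) (hZ : 0 < Z) (hm : 7 / 16 * σ ≤ m) :
    Δ ^ 2 * (exp (-(Δ / 6) ^ 2 / (2 * σ ^ 2)) / Z) / (w / Z * m) ≤ ε / 2000 ∧
      (w / Z * (16 * σ ^ 3) + Δ ^ 3 * (exp (-(Δ / 6) ^ 2 / (2 * σ ^ 2)) / Z)) / (w / Z * m) ≤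
        39 * σ ^ 2 := by
  have hexp' : Δ ≤ ε * η * exp (Δ ^ 2 / (144 * σ ^ 2)) := by
    refine hexp.trans ?_
    gcongr
    rw [div_pow, mul_pow]
    gcongr
    norm_num
  obtain ⟨hc1, hc2⟩ := contamination_le hσ hη hε hεΔ hu hexp'
  have hΔ : 0 < Δ := hε.trans_le hεΔ
  have hw0 : 0 < w := hη.trans_le hw
  have hm0 : 0 < m := by linarith
  set δ := exp (-(Δ / 6) ^ 2 / (2 * σ ^ 2)) with hδdef
  have hδ0 : 0 < δ := exp_pos _
  have hden : η * σ * (7 / 16) ≤ w * m := by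
    calc η * σ * (7 / 16) = η * (7 / 16 * σ) := by ring
      _ ≤ _ := by gcongr
  constructor
  · calc Δ ^ 2 * (δ / Z) / (w / Z * m) = Δ ^ 2 * δ / (w * m) := by field_simp
      _ ≤ Δ ^ 2 * δ / (η * σ * (7 / 16)) := by gcongr
      _ = Δ ^ 2 * δ / (η * σ) * (16 / 7) := by field_simp
      _ ≤ ε / 5000 * (16 / 7) := by gcongr
      _ ≤ ε / 2000 := by linarith
  · calc (w / Z * (16 * σ ^ 3) + Δ ^ 3 * (δ / Z)) / (w / Z * m)
        = 16 * σ ^ 3 / m + Δ ^ 3 * δ / (w * m) := by field_simp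
      _ ≤ 16 * σ ^ 3 / (7 / 16 * σ) + Δ ^ 3 * δ / (η * σ * (7 / 16)) := by gcongr
      _ = 256 / 7 * σ ^ 2 + Δ ^ 3 * δ / (η * σ) * (16 / 7) := by field_simp; ring
      _ ≤ 256 / 7 * σ ^ 2 + σ ^ 2 * (16 / 7) := by gcongr
      _ ≤ 39 * σ ^ 2 := by nlinarith [sq_nonneg σ]

lemma le_truncatedVariance_div {σ a b φ : ℝ} (hσ : 0 < σ) (hab : σ ≤ b - a) (hφ : φ ∈ Icc a b) :
    1 / 1000 ≤ truncatedVariance σ a b φ / σ ^ 2 := by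
  have := le_truncatedVariance (ℓ := σ / 2) hσ (by positivity) (by linarith) (by linarith) hφ
  rw [le_div_iff₀ (by positivity)]
  refine le_trans ?_ this
  rw [le_div_iff₀ (by positivity)]
  nlinarith [pow_pos hσ 3]

lemma mul_le_of_wide {σ Δ ε η : ℝ} (hσ : 0 < σ) (hΔ : 0 < Δ) (hη1 : η ≤ 1) (hε : 0 < ε)
    (hu : Δ < 720000 * σ) (hexp : Δ ≤ ε * η * exp ((Δ / (2160000 * σ)) ^ 2)) :
    5 / 6 * Δ ≤ ε := by
  have hs : Δ / (2160000 * σ) ≤ 1 / 3 := by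
    rw [div_le_iff₀ (by positivity)]; linarith
  have hs2 : (Δ / (2160000 * σ)) ^ 2 ≤ 1 / 9 := by
    have := pow_le_pow_left₀ (by positivity) hs 2
    norm_num at this ⊢; linarith
  have he : exp ((Δ / (2160000 * σ)) ^ 2) ≤ 9 / 8 := by
    have h1 := exp_le_exp.2 hs2
    have h2 := add_one_le_exp (-(1 / 9 : ℝ))
    have h3 : exp (1 / 9 : ℝ) * exp (-(1 / 9)) = 1 := by
      rw [← exp_add]; simp
    nlinarith [exp_pos (1 / 9 : ℝ)]
  have : Δ ≤ ε * 1 * (9 / 8) := hexp.trans (by gcongr)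
  linarith

lemma natCast_mul_inv_measure_le {P : Measure ℝ} [IsProbabilityMeasure P] {D : Set ℝ} {q r : ℝ}
    {M : ℕ} (hq : 0 < q) (hD : q ≤ P.real D) (hr : M * (1 / q) ≤ r) :
    (M : ℝ≥0∞) * (P D)⁻¹ ≤ ENNReal.ofReal r := by
  have h1 : ENNReal.ofReal q ≤ P D := ENNReal.ofReal_le_of_le_toReal hD
  calc (M : ℝ≥0∞) * (P D)⁻¹ ≤ M * (ENNReal.ofReal q)⁻¹ := by gcongr
    _ = ENNReal.ofReal (M * (1 / q)) := by
        rw [ENNReal.ofReal_mul (by positivity), ENNReal.ofReal_natCast, one_div,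
          ENNReal.ofReal_inv_of_pos hq]
    _ ≤ _ := ENNReal.ofReal_le_ofReal hr

end PhaseEstimation

open PhaseEstimation

theorem theorem3 (κ₁ κ₂ : ℝ) (hκ₁ : 0 < κ₁) (hκ₂ : κ₁ ≤ κ₂) :
    -- the constant in the lower bound on `t`
    ∃ c₀ : ℝ, 0 < c₀ ∧
    -- the constant `C` in the cost bounds may depend on the bound `B` for `t * ε`
    ∀ B : ℝ, 0 < B → ∃ C : ℝ, 0 < C ∧
    ∀ (Δ η ε σ : ℝ) (t : ℕ),
      0 < Δ → Δ ≤ Real.pi → 0 < η → 0 < ε → ε ≤ Δ → 0 < σ →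
      -- a circuit with `t` calls to `U` has a kernel of width `σ = Θ(1/t)`
      κ₁ ≤ t * σ → t * σ ≤ κ₂ →
      c₀ * Δ⁻¹ * Real.sqrt (Real.log (Δ * ε⁻¹ * η⁻¹)) ≤ t →
      t * ε ≤ B →
      -- the number `M` of filtered samples is chosen without knowledge of `U` and `ψ`
      ∃ M : ℕ, 1 ≤ M ∧
      ∀ (H : Type*) [NormedAddCommGroup H] [InnerProductSpace ℂ H] (U : H ≃ₗᵢ[ℂ] H)
        (ι : Type*) [Fintype ι] (E : PhaseEstimation.EigenDecomposition U ι) (j₀ : ι)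
        (ψ : H) (g : ℝ),
        (∀ j, j ≠ j₀ → Δ < |E.phase j - E.phase j₀|) →
        ‖ψ‖ = 1 → η < E.weight ψ j₀ →
        |E.phase j₀ - g| < Δ / 3 →
        PhaseEstimation.filterInterval g Δ ⊆ Set.Ico (Δ / 6) (2 * Real.pi - Δ / 6) →
        -- the estimate is well defined
        (∀ x : Fin M → ℝ, (∀ i, x i ∈ PhaseEstimation.filterInterval g Δ) →
          ∃! φ : ℝ, PhaseEstimation.IsFMPE (PhaseEstimation.gaussianKernel σ)
            (PhaseEstimation.filterInterval g Δ) x φ) ∧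
        ∀ (est : (Fin M → ℝ) → ℝ),
          (∀ x : Fin M → ℝ, (∀ i, x i ∈ PhaseEstimation.filterInterval g Δ) →
            PhaseEstimation.IsFMPE (PhaseEstimation.gaussianKernel σ)
              (PhaseEstimation.filterInterval g Δ) x (est x)) →
        -- independent circuit runs
        ∀ (Ω : Type*) [MeasurableSpace Ω] (μ : Measure Ω) [IsProbabilityMeasure μ]
          (X : Fin M → ℕ → Ω → ℝ),
          (∀ i k, HasLaw (X i k) (E.outcomeLaw ψ (PhaseEstimation.gaussianKernel σ)) μ) →
          iIndepFun (fun (p : Fin M × ℕ) => X p.1 p.2) μ →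
          -- root-mean-square error
          (Integrable (fun ω => (est (PhaseEstimation.filteredSamples
              (PhaseEstimation.filterInterval g Δ) fun i k => X i k ω) - E.phase j₀) ^ 2) μ ∧
            Real.sqrt (∫ ω, (est (PhaseEstimation.filteredSamples
              (PhaseEstimation.filterInterval g Δ) fun i k => X i k ω) - E.phase j₀) ^ 2 ∂μ)
                ≤ ε) ∧
          -- expected number of circuit samples
          ∫⁻ ω, PhaseEstimation.totalRuns (PhaseEstimation.filterInterval g Δ)
              (fun i k => X i k ω) ∂μ
            ≤ ENNReal.ofReal (C * η⁻¹ * ((t : ℝ) ^ 2)⁻¹ * (ε ^ 2)⁻¹) ∧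
          -- expected total number of calls to `U`
          ∫⁻ ω, PhaseEstimation.totalCalls t (PhaseEstimation.filterInterval g Δ)
              (fun i k => X i k ω) ∂μ
            ≤ ENNReal.ofReal (C * η⁻¹ * (t : ℝ)⁻¹ * (ε ^ 2)⁻¹) := by
  have hκ : 0 < κ₂ := hκ₁.trans_le hκ₂
  refine ⟨2160000 * κ₂, by positivity, fun B hB =>
    ⟨7 * (60000000 * κ₂ ^ 2 + 2 * B ^ 2), by positivity, ?_⟩⟩
  intro Δ η ε σ t hΔ hΔπ hη hε hεΔ hσ hκt htκ ht htB
  have ht0 : (0 : ℝ) < t := pos_of_mul_pos_left (hκ₁.trans_le hκt) hσ.le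
  have hexp := le_mul_exp_of_sqrt_log_le hκ hΔ hη hε hσ htκ ht
  classical
  refine ⟨if 720000 * σ ≤ Δ then ⌈60000000 * σ ^ 2 / ε ^ 2⌉₊ + 1 else 1,
    by split_ifs <;> omega, ?_⟩
  generalize hMdef : (if 720000 * σ ≤ Δ then ⌈60000000 * σ ^ 2 / ε ^ 2⌉₊ + 1 else 1) = M
  have hM1 : 1 ≤ M := by rw [← hMdef]; split_ifs <;> omega
  intro H _ _ U ι _ E j₀ ψ g hgap hψ hover hguess hD
  have hlt : g - Δ / 2 < g + Δ / 2 := by linarith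
  have hlen : g + Δ / 2 - (g - Δ / 2) = Δ := by ring
  have hwidth : g + Δ / 2 - (g - Δ / 2) ≤ Real.pi := by linarith
  obtain ⟨hg1, hg2⟩ := abs_lt.1 hguess
  have hφ₀ : E.phase j₀ ∈ Set.Icc (g - Δ / 2) (g + Δ / 2) := ⟨by linarith, by linarith⟩
  have hη1 : η ≤ 1 := hover.le.trans (E.weight_le_one hψ j₀)
  refine ⟨fun x hx => ?_, ?_⟩
  · simpa only [filterInterval, isFMPE_gaussianKernel_iff hσ hlt hwidth hM1 hx] using
      existsUnique_isMaxOn_meanLogLikelihood hσ hlt _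
  intro est hest Ω _ μ _ X hlaw hind
  have hprob : IsProbabilityMeasure (E.outcomeLaw ψ (gaussianKernel σ)) :=
    (hlaw ⟨0, hM1⟩ 0).isProbabilityMeasure_iff.1 inferInstance
  have hnear : ∀ x ∈ Set.Icc (g - Δ / 2) (g + Δ / 2), |x - E.phase j₀| ≤ Real.pi := fun x hx =>
    abs_le.2 ⟨by linarith [hx.1, hφ₀.2], by linarith [hx.2, hφ₀.1]⟩
  have hrestr := E.outcomeLaw_restrict ψ σ (a := g - Δ / 2) (b := g + Δ / 2) fun x hx =>
    ⟨by linarith [(hD hx).1], by linarith [(hD hx).2]⟩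
  have hlo : ∀ x ∈ Set.Icc (g - Δ / 2) (g + Δ / 2), _ ≤ E.density ψ σ x := fun x hx =>
    E.le_density (ψ := ψ) (σ := σ) (hnear x hx)
  have hhi : ∀ x ∈ Set.Icc (g - Δ / 2) (g + Δ / 2), E.density ψ σ x ≤ _ := fun x hx =>
    E.density_le hσ hψ (by positivity : 0 ≤ Δ / 6) (hnear x hx) fun j hj n =>
      le_abs_sub_sub_int_mul_two_pi (E.phase_mem j) (hgap j hj) hguess hx hD n
  have hZ := kernelMass_pos σ
  have hw : 0 < E.weight ψ j₀ := hη.trans hover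
  have hA : 0 < E.weight ψ j₀ / kernelMass σ := div_pos hw hZ
  have hR : 0 ≤ Real.exp (-(Δ / 6) ^ 2 / (2 * σ ^ 2)) / kernelMass σ := by positivity
  have hm0 := truncatedMass_pos hσ hlt hφ₀
  have hacc := mul_truncatedMass_le_measureReal hA.le (E.measurable_density ψ σ) hlo hhi hrestr
  have hbias := abs_integral_cond_sub_truncatedMean_le hσ hlt hφ₀ hA hR (E.measurable_density ψ σ)
    hlo hhi hrestr
  have hvar := variance_cond_le hσ hlt hφ₀ hA hR (E.measurable_density ψ σ) hlo hhi hrestr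
  rw [hlen] at hbias hvar
  have hmin : 7 / 16 * min σ Δ ≤ truncatedMass σ (g - Δ / 2) (g + Δ / 2) (E.phase j₀) := by
    have := le_truncatedMass (ℓ := min σ Δ / 2) hσ (by have := lt_min hσ hΔ; positivity)
      (by linarith [min_le_left σ Δ]) (by linarith [min_le_right σ Δ]) hφ₀
    linarith
  set m := truncatedMass σ (g - Δ / 2) (g + Δ / 2) (E.phase j₀) with hmdef
  set P := E.outcomeLaw ψ (gaussianKernel σ) with hPdef
  have hPpos : 0 < P.real (Set.Icc (g - Δ / 2) (g + Δ / 2)) := (mul_pos hA hm0).trans_le hacc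
  have hPD : P (Set.Icc (g - Δ / 2) (g + Δ / 2)) ≠ 0 := fun h => by
    simp [Measure.real, h] at hPpos
  obtain ⟨hruns, hYlaw, hYind⟩ := rejectionSampling measurableSet_Icc hPD hlaw hind
  have hsupp : ∀ᵐ y ∂P[|Set.Icc (g - Δ / 2) (g + Δ / 2)], y ∈ Set.Icc (g - Δ / 2) (g + Δ / 2) :=
    ae_cond_mem measurableSet_Icc
  obtain ⟨hinteg, hspec⟩ := integrable_sq_fmpe_sub (φ₀ := E.phase j₀) hσ hlt hwidth hM1 hsupp hYlaw
    hest
  have hq : η * m / (3 * σ) ≤ P.real (Set.Icc (g - Δ / 2) (g + Δ / 2)) := by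
    refine le_trans ?_ hacc
    rw [div_mul_eq_mul_div]
    have := kernelMass_le hσ
    gcongr
  have hcost : (M : ℝ) * (1 / (η * m / (3 * σ))) ≤
      7 * (60000000 * κ₂ ^ 2 + 2 * B ^ 2) * η⁻¹ * ((t : ℝ) ^ 2)⁻¹ * (ε ^ 2)⁻¹ := by
    rw [one_div_div]
    by_cases hcase : 720000 * σ ≤ Δ
    · rw [if_pos hcase] at hMdef
      refine cost_le_of_narrow hη hε hσ ht0 htκ htB ?_ ?_
      · rwa [min_eq_left (by linarith)] at hmin
      · have := (Nat.ceil_lt_add_one (by positivity : 0 ≤ 60000000 * σ ^ 2 / ε ^ 2)).le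
        rw [← hMdef]; push_cast; linarith
    · rw [if_neg hcase] at hMdef
      rw [← hMdef, Nat.cast_one, one_mul]
      exact cost_le_of_wide hη hε hεΔ hσ ht0 htκ htB hmin
  have htotal := hruns.trans (natCast_mul_inv_measure_le (by positivity) hq hcost)
  refine ⟨⟨hinteg, Real.sqrt_le_iff.2 ⟨hε.le, ?_⟩⟩, htotal, ?_⟩
  · by_cases hcase : 720000 * σ ≤ Δ
    · rw [if_pos hcase] at hMdef
      have hmσ : 7 / 16 * σ ≤ m := by rwa [min_eq_left (by linarith)] at hmin
      obtain ⟨hb, hv⟩ := contaminated_moments_le hσ hη hε hεΔ hcase hexp hover.le hZ hmσ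
      have hbias' := hbias.trans hb
      have hvar' := hvar.trans hv
      have hc : ∀ φ ∈ Set.Icc (g - Δ / 2) (g + Δ / 2),
          1 / 1000 ≤ truncatedVariance σ (g - Δ / 2) (g + Δ / 2) φ / σ ^ 2 := fun φ hφ =>
        le_truncatedVariance_div hσ (by linarith) hφ
      have hmse := integral_sq_fmpe_sub_le hσ hlt hwidth hφ₀ (by norm_num) hc hM1 hsupp hYlaw hYind
        hest
      have hMpos : (0 : ℝ) < M := by exact_mod_cast hM1
      have hMlarge : 60000000 * σ ^ 2 ≤ M * ε ^ 2 := by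
        rw [← div_le_iff₀ (by positivity), ← hMdef]
        push_cast
        linarith [Nat.le_ceil (60000000 * σ ^ 2 / ε ^ 2)]
      have hvarM : Var[id; P[|Set.Icc (g - Δ / 2) (g + Δ / 2)]] / M ≤ 39 / 60000000 * ε ^ 2 := by
        rw [div_le_iff₀ hMpos]
        linarith
      have hb2 := sq_le_sq.2 (hbias'.trans (le_abs_self _))
      change (1 / 1000) ^ 2 * (∫ ω, (est (filteredSamples (filterInterval g Δ)
        fun i k => X i k ω) - E.phase j₀) ^ 2 ∂μ) ≤ _ at hmse
      nlinarith [sq_nonneg ε]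
    · push Not at hcase
      have hΔε := mul_le_of_wide hσ hΔ hη1 hε hcase hexp
      have hae : ∀ᵐ ω ∂μ, (est (filteredSamples (filterInterval g Δ) fun i k => X i k ω) -
          E.phase j₀) ^ 2 ≤ ε ^ 2 := by
        filter_upwards [hspec] with ω hω
        obtain ⟨h1, h2⟩ := hω.1
        change _ ≤ est (filteredSamples (filterInterval g Δ) fun i k => X i k ω) at h1
        change est (filteredSamples (filterInterval g Δ) fun i k => X i k ω) ≤ _ at h2
        exact sq_le_sq' (by linarith) (by linarith)
      exact (integral_mono_ae hinteg (integrable_const (ε ^ 2)) hae).trans_eq (by simp)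
  · simp only [totalCalls]
    rw [lintegral_const_mul' _ _ (ENNReal.natCast_ne_top t)]
    calc (t : ℝ≥0∞) * ∫⁻ ω, totalRuns (filterInterval g Δ) (fun i k => X i k ω) ∂μ
        ≤ t * ENNReal.ofReal (7 * (60000000 * κ₂ ^ 2 + 2 * B ^ 2) * η⁻¹ * ((t : ℝ) ^ 2)⁻¹ *
          (ε ^ 2)⁻¹) := by gcongr; exact htotal
      _ = _ := by
          rw [← ENNReal.ofReal_natCast t, ← ENNReal.ofReal_mul ht0.le]
          congr 1
          field_simp
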